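/- **Setting.** Fix dimensions $d\ge 1$ and $s$, constants $\mu,L>0$, $R=L/(2\mu)$, a forget ratio $r_f\in[0,1)$, and probability distributions $\mathcal D_r$ (retain) and $\mathcal D_f$ (forget) on $\mathbb R^s$; let $\mathcal D=r_f\mathcal D_f+(1-r_f)\mathcal D_r$. Let $\mathcal F_{sc}$ be the class of measurable losses $\ell:\mathbb R^d\times\mathbb R^s\to\mathbb R$ such that each $\ell(\cdot,\xi)$ is differentiable, and $L$-Lipschitz and $\mu$-strongly convex on the ball $\mathbb B(0,R)$, and such that $\mathcal L_r(\theta)=\mathbb E_{\xi\sim\mathcal D_r}[\ell(\theta,\xi)]$ and $\mathcal L(\theta)=\mathbb E_{\xi\sim\mathcal D}[\ell(\theta,\xi)]$ are finite and have unique minimizers $\theta_r^*$, $\theta^*$ over $\mathbb R^d$, both lying in $\mathbb B(0,R)$; put $\mathcal L_r^*=\mathcal L_r(\theta_r^*)$. An update rule $A$ consists of a random seed $\omega$ drawn once, a measurable preparation $(\theta_0,\omega)\mapsto(\theta_0',m_0)$ of the model and of a memory state, which uses no gradient (for instance adding noise), and a measurable update $(\theta_{t+1},m_{t+1})=A(\theta_t,\nabla\ell(\theta_t,\xi_t),m_t,\omega)$,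 where $\xi_0,\xi_1,\dots$ are i.i.d. with law $\mathcal D_r$ and independent of $\omega$. Its output after $T$ iterations is denoted $\mathcal A(T,\ell,\mathcal D_r)$ when started from $\theta_0=0$ (learning) and $\mathcal U(T,\ell,\mathcal D_r,\mathcal D_f)$ when started from $\theta_0=\theta^*$ (unlearning). $\mathcal U$ satisfies $(\epsilon,\delta)$-unlearning if, for all $T$, all probability distributions $\mathcal D_r,\mathcal D_f,\mathcal D_f'$ on $\mathbb R^s$, every loss $\ell$ that is in $\mathcal F_{sc}$ both for $(\mathcal D_r,\mathcal D_f)$ and for $(\mathcal D_r,\mathcal D_f')$, and every measurable $S\subset\mathbb R^d$, $\mathbb P[\mathcal U(T,\ell,\mathcal D_r,\mathcal D_f)\in S]\le e^{\epsilon}\,\mathbb P[\mathcal U(T,\ell,\mathcal D_r,\mathcal D_f')\in S]+\delta$. For a target excess risk $e>0$, let $T^S_e(\ell,\mathcal A)$ (resp. $T^U_e(\ell,\mathcal U)$) be the least number $T$ of iterations from which on the expected excess risk $\mathbb E[\mathcal L_r(\cdot)-\mathcal L_r^*]$ of the output of $\mathcal A$ (resp. $\mathcal U$) is at most $e$, and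 let $$T^S_e=\inf_{\mathcal A}\ \sup_{\ell\in\mathcal F_{sc}}T^S_e(\ell,\mathcal A),\qquad T^U_e=\inf_{\mathcal U\ (\epsilon,\delta)\text{-unlearning}}\ \sup_{\ell\in\mathcal F_{sc}}T^U_e(\ell,\mathcal U).$$ Let $\kappa=\epsilon^{-1}\sqrt{2\ln(1.25/\delta)}$ and $e_0=L^2/(8\mu)$. **Flexible-distributions assumption.** For every $p\in[0,1]$ there is a measurable $A\subset\mathbb R^s$ with $\mathcal D_r(A)=p$; and there is a probability distribution $\mathcal D_f'$ on $\mathbb R^s$ such that the supports of $\mathcal D_r,\mathcal D_f,\mathcal D_f'$ are pairwise disjoint. **Theorem 2 (inefficient regime).** There are universal constants $c>0$ and $K>0$ such that, in the above setting, if $\delta\in[10^{-8},\epsilon]$, the flexible-distributions assumption holds and $$0<e<\min\Big\{1,\ c\Big(\frac{r_f}{1-r_f}\Big)^2(1+\kappa^2)\Big\}\,e_0,$$ then $0<T^S_e<\infty$, $T^U_e<\infty$ and $$\frac{T^U_e}{T^S_e}\ \ge\ K,\qquad\text{i.e. } \frac{T^U_e}{T^S_e}=\Omega(1).$$ -/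

import Mathlib

open MeasureTheory
open scoped ENNReal

noncomputable section

namespace Unlearning

/-- `ℝ^n` with the Euclidean norm; model parameters live in `Euc d`, data points in `Euc s`. -/
abbrev Euc (n : ℕ) : Type := EuclideanSpace ℝ (Fin n)

/-! ### Data distributions -/

/-- The full distribution `r_f D_f + (1 - r_f) D_r`. -/
def mixture {s : ℕ} (rf : ℝ) (Dr Df : Measure (Euc s)) : Measure (Euc s) :=
  ENNReal.ofReal rf • Df + ENNReal.ofReal (1 - rf) • Dr

/-- Flexible distributions: every probability is attained by an event under the retain
distribution, and there is a third distribution such that the three supports are pairwise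
disjoint. -/
def FlexibleDistributions {s : ℕ} (Dr Df : Measure (Euc s)) : Prop :=
  (∀ p ∈ Set.Icc (0 : ℝ) 1, ∃ A : Set (Euc s), MeasurableSet A ∧ Dr A = ENNReal.ofReal p) ∧
  ∃ Dg : Measure (Euc s), IsProbabilityMeasure Dg ∧
    Disjoint Dr.support Df.support ∧ Disjoint Dr.support Dg.support ∧
    Disjoint Df.support Dg.support

/-! ### Losses, risks and minimizers -/

/-- The objective `θ ↦ E_{ξ ∼ P} [ℓ(θ, ξ)]`. -/
def risk {d s : ℕ} (loss : Euc d → Euc s → ℝ) (P : Measure (Euc s)) (θ : Euc d) : ℝ :=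
  ∫ ξ, loss θ ξ ∂P

/-- `x` is the unique minimizer of `f` over the whole space. -/
def IsUniqueMin {d : ℕ} (f : Euc d → ℝ) (x : Euc d) : Prop :=
  ∀ y, y ≠ x → f x < f y

/-- The unique minimizer over `ℝ^d` of the objective for the data distribution `P`
(it exists for every loss in `lossClass`). -/
def minimizer {d s : ℕ} (loss : Euc d → Euc s → ℝ) (P : Measure (Euc s)) : Euc d :=
  Classical.epsilon (IsUniqueMin (risk loss P))

/-- Every `ℓ(·, ξ)` is differentiable, and `L`-Lipschitz and `μ`-strongly convex on the closed
ball of radius `R = L / (2 μ)` centred at `0`. -/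
structure IsRegularLoss {d s : ℕ} (μ L : ℝ) (loss : Euc d → Euc s → ℝ) : Prop where
  measurable : Measurable (Function.uncurry loss)
  differentiable : ∀ ξ, Differentiable ℝ (fun θ => loss θ ξ)
  lipschitz : ∀ ξ, ∀ θ ∈ Metric.closedBall (0 : Euc d) (L / (2 * μ)),
    ∀ η ∈ Metric.closedBall (0 : Euc d) (L / (2 * μ)),
      |loss θ ξ - loss η ξ| ≤ L * ‖θ - η‖
  strongly_convex : ∀ ξ, ∀ θ ∈ Metric.closedBall (0 : Euc d) (L / (2 * μ)),
    ∀ η ∈ Metric.closedBall (0 : Euc d) (L / (2 * μ)),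
      loss θ ξ + inner ℝ (gradient (fun ζ => loss ζ ξ) θ) (η - θ) + μ / 2 * ‖η - θ‖ ^ 2
        ≤ loss η ξ

/-- The objective for the distribution `P` is finite on `ℝ^d` and has a unique minimizer over
`ℝ^d`, which lies in the ball of radius `R = L / (2 μ)`. (For a regular loss, the minimizer over
the ball is unique and is a critical point; the condition therefore only excludes losses whose
objective takes smaller or equal values off the ball, where nothing else is required.) -/
def WellPosed {d s : ℕ} (μ L : ℝ) (P : Measure (Euc s)) (loss : Euc d → Euc s → ℝ) : Prop :=
  (∀ θ, Integrable (loss θ) P) ∧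
  ∃ θ ∈ Metric.closedBall (0 : Euc d) (L / (2 * μ)), IsUniqueMin (risk loss P) θ

/-- The class `F_sc(μ, L)` of losses. -/
def lossClass {d s : ℕ} (μ L rf : ℝ) (Dr Df : Measure (Euc s)) :
    Set (Euc d → Euc s → ℝ) :=
  {loss | IsRegularLoss μ L loss ∧ WellPosed μ L Dr loss ∧ WellPosed μ L (mixture rf Dr Df) loss}

/-! ### Iterative first-order algorithms -/

/-- An update rule: a memory space, a random seed drawn once, a (possibly randomized)
preparation `start` of the model and of the memory before any gradient is accessed, and a
measurable update `step (θ_t, ∇_t, m_t, ω) = (θ_{t+1}, m_{t+1})`. -/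
structure UpdateRule (d : ℕ) : Type 1 where
  Mem : Type
  memSpace : MeasurableSpace Mem
  Seed : Type
  seedSpace : MeasurableSpace Seed
  seedLaw : Measure Seed
  seedProb : IsProbabilityMeasure seedLaw
  start : Euc d × Seed → Euc d × Mem
  measurable_start : Measurable start
  step : Euc d × Euc d × Mem × Seed → Euc d × Mem
  measurable_step : Measurable step

attribute [instance] UpdateRule.memSpace UpdateRule.seedSpace UpdateRule.seedProb

/-- Model and memory after `t` iterations from the initial model `θ₀`, with seed `ω` and data
points `ξ 0, ξ 1, …`. Each iteration accesses one stochastic gradient at the current model. -/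
def UpdateRule.run {d s : ℕ} (A : UpdateRule d) (loss : Euc d → Euc s → ℝ) (θ₀ : Euc d)
    (ω : A.Seed) (ξ : ℕ → Euc s) : ℕ → Euc d × A.Mem
  | 0 => A.start (θ₀, ω)
  | t + 1 =>
    let p := A.run loss θ₀ ω ξ t
    A.step (p.1, gradient (fun ζ => loss ζ (ξ t)) p.1, p.2, ω)

/-- Law of the model after `T` iterations, the data points being i.i.d. with law `P` and
independent of the seed. -/
def UpdateRule.outputLaw {d s : ℕ} (A : UpdateRule d) (T : ℕ) (θ₀ : Euc d)
    (loss : Euc d → Euc s → ℝ) (P : Measure (Euc s)) [IsProbabilityMeasure P] :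
    Measure (Euc d) :=
  (A.seedLaw.prod (Measure.infinitePi (fun _ : ℕ => P))).map
    (fun x => (A.run loss θ₀ x.1 x.2 T).1)

/-- Output law of the learning algorithm of `A`: run on the retain distribution from `0`. -/
def UpdateRule.learn {d s : ℕ} (A : UpdateRule d) (T : ℕ) (loss : Euc d → Euc s → ℝ)
    (Dr : Measure (Euc s)) [IsProbabilityMeasure Dr] : Measure (Euc d) :=
  A.outputLaw T 0 loss Dr

/-- Output law of the unlearning algorithm of `A`: run on the retain distribution from the
minimizer of the objective for the full distribution. -/
def UpdateRule.unlearn {d s : ℕ} (A : UpdateRule d) (rf : ℝ) (T : ℕ)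
    (loss : Euc d → Euc s → ℝ) (Dr Df : Measure (Euc s)) [IsProbabilityMeasure Dr] :
    Measure (Euc d) :=
  A.outputLaw T (minimizer loss (mixture rf Dr Df)) loss Dr

/-- The set `U_{ε,δ}` of update rules whose unlearning algorithm satisfies `(ε, δ)`-unlearning:
for each number of iterations, the output is nearly insensitive to the forget distribution. -/
def unlearningRules (d s : ℕ) (μ L rf ε δ : ℝ) : Set (UpdateRule d) :=
  {A | ∀ (T : ℕ) (Dr Df Dg : Measure (Euc s)) [IsProbabilityMeasure Dr]
      [IsProbabilityMeasure Df] [IsProbabilityMeasure Dg] (loss : Euc d → Euc s → ℝ),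
      loss ∈ lossClass μ L rf Dr Df → loss ∈ lossClass μ L rf Dr Dg →
      ∀ S : Set (Euc d), MeasurableSet S →
        A.unlearn rf T loss Dr Df S
          ≤ ENNReal.ofReal (Real.exp ε) * A.unlearn rf T loss Dr Dg S + ENNReal.ofReal δ}

/-! ### Computation times -/

/-- Expected excess risk on `Dr` of a random model with law `Q`. The excess risk is nonnegative
for losses in `lossClass`, so the expectation is a value in `[0, ∞]`. -/
def expectedExcess {d s : ℕ} (loss : Euc d → Euc s → ℝ) (Dr : Measure (Euc s))
    (Q : Measure (Euc d)) : ℝ≥0∞ :=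
  ∫⁻ θ, ENNReal.ofReal (risk loss Dr θ - risk loss Dr (minimizer loss Dr)) ∂Q

/-- The least number of iterations from which on the quantity `excess T` is at most `e`
(`⊤` if there is none). -/
def timeToReach (e : ℝ) (excess : ℕ → ℝ≥0∞) : ℕ∞ :=
  ⨅ (T : ℕ) (_ : ∀ n ≥ T, excess n ≤ ENNReal.ofReal e), (T : ℕ∞)

/-- Minimax retraining time `T^S_e`. -/
def retrainTime {s : ℕ} (d : ℕ) (μ L rf e : ℝ) (Dr Df : Measure (Euc s))
    [IsProbabilityMeasure Dr] : ℕ∞ :=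
  ⨅ A : UpdateRule d, ⨆ loss ∈ lossClass (d := d) μ L rf Dr Df,
    timeToReach e (fun T => expectedExcess loss Dr (A.learn T loss Dr))

/-- Minimax unlearning time `T^U_e` under `(ε, δ)`-unlearning. -/
def unlearnTime {s : ℕ} (d : ℕ) (μ L rf ε δ e : ℝ) (Dr Df : Measure (Euc s))
    [IsProbabilityMeasure Dr] : ℕ∞ :=
  ⨅ A ∈ unlearningRules d s μ L rf ε δ, ⨆ loss ∈ lossClass (d := d) μ L rf Dr Df,
    timeToReach e (fun T => expectedExcess loss Dr (A.unlearn rf T loss Dr Df))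

/-- Strength of the privacy constraint, `κ = ε⁻¹ √(2 ln(1.25 / δ))`. -/
def kappa (ε δ : ℝ) : ℝ := ε⁻¹ * Real.sqrt (2 * Real.log (1.25 / δ))

/-- The trivial excess risk `e₀ = L² / (8 μ)`. -/
def trivialRisk (μ L : ℝ) : ℝ := L ^ 2 / (8 * μ)

end Unlearning

end

/-!
Write `R = L / (2 μ)`, `ρ = rf / (1 - rf)` and `e₀ = μ R² / 2`. Both computation times are of the
order of `e₀ / e`.

Upper bounds. Projected stochastic gradient descent from `0` with step sizes `2 / (μ (t + 2))`,
averaged over `N` iterations with weights `t + 1`, has expected excess risk at most `64 e₀ / N`: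
strong convexity makes the weighted regret telescope along every data sequence
(`sgd_weighted_regret`), and an iterate is independent of the next data point
(`integral_loss_sgd_sub`). The rule that moves to this average at iteration `N` and then stays there
bounds the retraining time. It ignores the initial model, so its output law does not depend on the
forget distribution and it also bounds the unlearning time.

Lower bound. Tilt the loss `μ / 2 ‖θ‖²` by `(L / 2) h(ξ) ⟪u, θ⟫`, where `h` has mean `±γ` under the
retain distribution and, on the support of the forget distribution, is the constant `∓γ / ρ`, which
is allowed as soon as `γ ≤ ρ`. Then `h` has mean `0` under the mixture, the minimizer `θ* = 0`
carries no information about the retain minimizer `∓γ R u`, and a rule has to find the sign from the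
gradients, that is, from independent signs of mean `±γ`. The product laws of `T` such signs overlap
by at least `(1 - T γ²) / 2` (`le_signOverlap`), and a wrong decision costs `γ² e₀`
(`exists_loss_lt_expectedExcess`). With `γ² = 4 e / e₀`, an excess risk of
`e ≤ ρ² e₀ / 4` takes at least `e₀ / (8 e)` iterations. For `T = 0` the overlap is complete and
`γ = min 1 ρ` shows that no rule reaches an excess `e < (min 1 ρ)² e₀` without a gradient.

The role of `κ`. Since `10⁻⁸ ≤ δ ≤ ε`, one has `κ² ≤ 4 · 10¹⁷` (`kappa_sq_le`), so a universal `c`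
can absorb the factor `1 + κ²`, so that `4 e < ρ² e₀` and `γ ≤ ρ`. A `c` of comparable smallness is forced:
for `d = 1` and `rf < 1 / 2`, the rule that outputs a small multiple of `θ*` with probability `δ` and
`0` otherwise is `(ε, δ)`-unlearning and reaches some `e < e₀` without any gradient, so that the
unlearning time vanishes for such `e`. Hence `c ρ² (1 + κ²) < 1` is needed whenever `rf < 1 / 2`,
in particular for the largest possible `κ`.
-/

noncomputable section

namespace Unlearning

variable {d s : ℕ}

/-! ### Minimizers, gradients and measurability of runs -/

lemma IsUniqueMin.eq {f : Euc d → ℝ} {x y : Euc d} (hx : IsUniqueMin f x)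
    (hy : IsUniqueMin f y) : x = y := by
  by_contra h
  exact lt_asymm (hx y (Ne.symm h)) (hy x h)

lemma minimizer_eq {loss : Euc d → Euc s → ℝ} {P : Measure (Euc s)} {x : Euc d}
    (hx : IsUniqueMin (risk loss P) x) : minimizer loss P = x :=
  IsUniqueMin.eq (Classical.epsilon_spec (p := IsUniqueMin (risk loss P)) ⟨x, hx⟩) hx

lemma WellPosed.minimizer_mem {μ L : ℝ} {loss : Euc d → Euc s → ℝ} {P : Measure (Euc s)}
    (h : WellPosed μ L P loss) :
    minimizer loss P ∈ Metric.closedBall (0 : Euc d) (L / (2 * μ)) := by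
  obtain ⟨-, x, hx, hmin⟩ := h
  rwa [minimizer_eq hmin]

lemma WellPosed.risk_minimizer_le {μ L : ℝ} {loss : Euc d → Euc s → ℝ} {P : Measure (Euc s)}
    (h : WellPosed μ L P loss) (θ : Euc d) : risk loss P (minimizer loss P) ≤ risk loss P θ := by
  obtain ⟨-, x, -, hmin⟩ := h
  rw [minimizer_eq hmin]
  rcases eq_or_ne θ x with rfl | hne
  · exact le_rfl
  · exact (hmin θ hne).le

lemma hasFDerivAt_gradient {f : Euc d → ℝ} {x : Euc d} (hf : DifferentiableAt ℝ f x) :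
    HasFDerivAt f (innerSL ℝ (gradient f x)) x :=
  hf.hasGradientAt.hasFDerivAt

/-- Each coordinate of the gradient is a limit of difference quotients. -/
lemma IsRegularLoss.measurable_gradient {μ L : ℝ} {loss : Euc d → Euc s → ℝ}
    (h : IsRegularLoss μ L loss) :
    Measurable (fun p : Euc d × Euc s => gradient (fun ζ => loss ζ p.2) p.1) := by
  have hin : ∀ v : Euc d,
      Measurable (fun p : Euc d × Euc s => inner ℝ (gradient (fun ζ => loss ζ p.2) p.1) v) := by
    intro v
    refine measurable_of_tendsto_metrizable (f := fun (n : ℕ) (p : Euc d × Euc s) =>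
      (n : ℝ) • (loss (p.1 + (n : ℝ)⁻¹ • v) p.2 - loss p.1 p.2)) (fun n => ?_) ?_
    · refine Measurable.const_mul (Measurable.sub ?_ h.measurable) _
      exact h.measurable.comp
        (f := fun p : Euc d × Euc s => (p.1 + (n : ℝ)⁻¹ • v, p.2)) (by fun_prop)
    · rw [tendsto_pi_nhds]
      intro p
      exact (hasFDerivAt_gradient (h.differentiable p.2 p.1)).lim v (c := fun n : ℕ => (n : ℝ))
        (by simpa using tendsto_natCast_atTop_atTop)
  let b := EuclideanSpace.basisFun (Fin d) ℝ
  have hsum : (fun p : Euc d × Euc s => gradient (fun ζ => loss ζ p.2) p.1)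
      = fun p => ∑ i, inner ℝ (gradient (fun ζ => loss ζ p.2) p.1) (b i) • b i := by
    funext p
    conv_lhs => rw [← b.sum_repr' (gradient (fun ζ => loss ζ p.2) p.1)]
    exact Finset.sum_congr rfl fun i _ => by rw [real_inner_comm]
  rw [hsum]
  exact Finset.measurable_sum _ fun i _ => (hin (b i)).smul_const _

lemma UpdateRule.run_succ (A : UpdateRule d) (loss : Euc d → Euc s → ℝ) (θ₀ : Euc d) (ω : A.Seed)
    (ξ : ℕ → Euc s) (t : ℕ) :
    A.run loss θ₀ ω ξ (t + 1) = A.step ((A.run loss θ₀ ω ξ t).1,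
      gradient (fun ζ => loss ζ (ξ t)) (A.run loss θ₀ ω ξ t).1, (A.run loss θ₀ ω ξ t).2, ω) :=
  rfl

lemma UpdateRule.measurable_run (A : UpdateRule d) {μ L : ℝ} {loss : Euc d → Euc s → ℝ}
    (h : IsRegularLoss μ L loss) (θ₀ : Euc d) (t : ℕ) :
    Measurable (fun x : A.Seed × (ℕ → Euc s) => A.run loss θ₀ x.1 x.2 t) := by
  induction t with
  | zero => exact A.measurable_start.comp (by fun_prop)
  | succ t ih =>
    refine A.measurable_step.comp (ih.fst.prodMk (Measurable.prodMk ?_ (ih.snd.prodMk ?_)))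
    · exact h.measurable_gradient.comp (ih.fst.prodMk (by fun_prop))
    · fun_prop

/-- The Lipschitz bound holds only on the ball, so at a boundary point the gradient `g` is tested
against the boundary point `∓ R g / ‖g‖` on the side where `⟪g, ·⟫` is at least `R ‖g‖` in
absolute value; this costs a factor `2`. -/
lemma IsRegularLoss.norm_gradient_le {μ L : ℝ} (hμ : 0 < μ) (hL : 0 < L)
    {loss : Euc d → Euc s → ℝ} (h : IsRegularLoss μ L loss) (ξ : Euc s) {θ : Euc d}
    (hθ : θ ∈ Metric.closedBall (0 : Euc d) (L / (2 * μ))) :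
    ‖gradient (fun ζ => loss ζ ξ) θ‖ ≤ 2 * L := by
  set g := gradient (fun ζ => loss ζ ξ) θ with hg
  set R := L / (2 * μ) with hR
  have hRpos : 0 < R := by positivity
  -- directional derivatives towards points of the ball are controlled by the Lipschitz constant
  have key : ∀ y ∈ Metric.closedBall (0 : Euc d) R, |inner ℝ g (y - θ)| ≤ 2 * L * R := by
    intro y hy
    have hlim := (hasFDerivAt_gradient (h.differentiable ξ θ)).lim (y - θ)
      (c := fun n : ℕ => ((n : ℝ) + 1)) (l := Filter.atTop)
      (by
        simp only [Real.norm_eq_abs]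
        refine Filter.tendsto_abs_atTop_atTop.comp ?_
        exact Filter.tendsto_atTop_add_const_right _ _ tendsto_natCast_atTop_atTop)
    refine le_of_tendsto hlim.abs (Filter.Eventually.of_forall fun n => ?_)
    have hn : (0 : ℝ) < (n : ℝ) + 1 := by positivity
    have hmem : θ + ((n : ℝ) + 1)⁻¹ • (y - θ) ∈ Metric.closedBall (0 : Euc d) R := by
      refine (convex_closedBall (0 : Euc d) R).add_smul_sub_mem hθ hy ⟨by positivity, ?_⟩
      exact inv_le_one_of_one_le₀ (by linarith [(Nat.cast_nonneg n : (0 : ℝ) ≤ n)])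
    have hl := h.lipschitz ξ _ hmem θ hθ
    have hd : ‖y - θ‖ ≤ 2 * R := by
      have h1 := norm_sub_le y θ
      rw [mem_closedBall_zero_iff] at hy hθ
      linarith
    rw [add_sub_cancel_left, norm_smul, norm_inv, Real.norm_of_nonneg hn.le] at hl
    rw [smul_eq_mul, abs_mul, abs_of_pos hn]
    calc ((n : ℝ) + 1) * |loss (θ + ((n : ℝ) + 1)⁻¹ • (y - θ)) ξ - loss θ ξ|
        ≤ ((n : ℝ) + 1) * (L * (((n : ℝ) + 1)⁻¹ * ‖y - θ‖)) := by gcongr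
      _ = L * ‖y - θ‖ := by field_simp
      _ ≤ 2 * L * R := by nlinarith
  rcases eq_or_ne g 0 with h0 | h0
  · rw [h0, norm_zero]; positivity
  have hgn : 0 < ‖g‖ := norm_pos_iff.2 h0
  have hball : ∀ σ : ℝ, |σ| = 1 → (σ * R / ‖g‖) • g ∈ Metric.closedBall (0 : Euc d) R := by
    intro σ hσ
    rw [mem_closedBall_zero_iff, norm_smul, norm_div, norm_mul, Real.norm_eq_abs σ, hσ,
      Real.norm_of_nonneg hRpos.le, norm_norm, one_mul, div_mul_cancel₀ _ hgn.ne']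
  have hinner : ∀ σ : ℝ, inner ℝ g ((σ * R / ‖g‖) • g - θ) = σ * R * ‖g‖ - inner ℝ g θ := by
    intro σ
    rw [inner_sub_right, inner_smul_right, real_inner_self_eq_norm_sq]
    field_simp
  have hfin : R * ‖g‖ ≤ R * (2 * L) := by
    rcases le_total (inner ℝ g θ) 0 with hs | hs
    · have := (abs_le.1 (key _ (hball 1 (by simp)))).2
      rw [hinner] at this
      linarith
    · have := (abs_le.1 (key _ (hball (-1) (by simp)))).1
      rw [hinner] at this
      linarith
  exact le_of_mul_le_mul_left hfin hRpos

/-! ### Projected stochastic gradient descent with weighted averaging -/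

/-- Metric projection onto the closed ball of radius `R` centred at `0`. -/
def ballProj (R : ℝ) (x : Euc d) : Euc d := (R / max R ‖x‖) • x

lemma ballProj_mem {R : ℝ} (hR : 0 < R) (x : Euc d) :
    ballProj R x ∈ Metric.closedBall (0 : Euc d) R := by
  have hm : 0 < max R ‖x‖ := lt_max_of_lt_left hR
  rw [mem_closedBall_zero_iff, ballProj, norm_smul, Real.norm_of_nonneg (by positivity),
    div_mul_eq_mul_div, div_le_iff₀ hm]
  exact mul_le_mul_of_nonneg_left (le_max_right _ _) hR.le

lemma norm_ballProj_sub_le {R : ℝ} (hR : 0 < R) (x : Euc d) {y : Euc d}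
    (hy : y ∈ Metric.closedBall (0 : Euc d) R) : ‖ballProj R x - y‖ ≤ ‖x - y‖ := by
  rw [mem_closedBall_zero_iff] at hy
  rcases le_total ‖x‖ R with hx | hx
  · rw [ballProj, max_eq_left hx, div_self hR.ne', one_smul]
  · have hxpos : 0 < ‖x‖ := hR.trans_le hx
    refine le_of_sq_le_sq ?_ (norm_nonneg _)
    rw [ballProj, max_eq_right hx, norm_sub_sq_real, norm_sub_sq_real, norm_smul, norm_div,
      norm_norm, Real.norm_of_nonneg hR.le, div_mul_cancel₀ _ hxpos.ne', real_inner_smul_left]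
    have hin : inner ℝ x y ≤ ‖x‖ * R :=
      (real_inner_le_norm x y).trans (mul_le_mul_of_nonneg_left hy hxpos.le)
    have hq : R / ‖x‖ ≤ 1 := (div_le_one hxpos).2 hx
    have hqx : R / ‖x‖ * (‖x‖ * R) = R ^ 2 := by field_simp
    nlinarith [mul_le_mul_of_nonneg_left hin (sub_nonneg.2 hq), sq_nonneg (‖x‖ - R)]

lemma measurable_ballProj (R : ℝ) : Measurable (ballProj R : Euc d → Euc d) := by
  unfold ballProj
  exact (measurable_const.div (measurable_const.max measurable_norm)).smul measurable_id

/-- Iterates of projected stochastic gradient descent on the ball of radius `L / (2 μ)`, started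
from `0`, with step sizes `2 / (μ (t + 2))`. -/
def sgd (μ L : ℝ) (loss : Euc d → Euc s → ℝ) (ξ : ℕ → Euc s) : ℕ → Euc d
  | 0 => 0
  | t + 1 => ballProj (L / (2 * μ)) (sgd μ L loss ξ t -
      (2 / (μ * (t + 2))) • gradient (fun ζ => loss ζ (ξ t)) (sgd μ L loss ξ t))

/-- Average of the first `N` iterates, the iterate `t` having weight proportional to `t + 1`. -/
def sgdAverage (μ L : ℝ) (loss : Euc d → Euc s → ℝ) (N : ℕ) (ξ : ℕ → Euc s) : Euc d :=
  (2 / (N * (N + 1) : ℝ)) • ∑ i ∈ Finset.range N, ((i : ℝ) + 1) • sgd μ L loss ξ i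

lemma sgd_mem {μ L : ℝ} (hμ : 0 < μ) (hL : 0 < L) (loss : Euc d → Euc s → ℝ) (ξ : ℕ → Euc s)
    (t : ℕ) : sgd μ L loss ξ t ∈ Metric.closedBall (0 : Euc d) (L / (2 * μ)) := by
  have hR : 0 < L / (2 * μ) := by positivity
  cases t with
  | zero => simpa [sgd] using hR.le
  | succ t => exact ballProj_mem hR _

lemma sgd_congr (μ L : ℝ) (loss : Euc d → Euc s → ℝ) {ξ η : ℕ → Euc s} (t : ℕ)
    (h : ∀ i < t, ξ i = η i) : sgd μ L loss ξ t = sgd μ L loss η t := by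
  induction t with
  | zero => rfl
  | succ t ih =>
    simp only [sgd]
    rw [ih fun i hi => h i (hi.trans t.lt_succ_self), h t t.lt_succ_self]

lemma measurable_sgd {μ L : ℝ} {loss : Euc d → Euc s → ℝ} (h : IsRegularLoss μ L loss) (t : ℕ) :
    Measurable (fun ξ => sgd μ L loss ξ t) := by
  induction t with
  | zero => exact measurable_const
  | succ t ih =>
    have hg : Measurable (fun ξ : ℕ → Euc s =>
        gradient (fun ζ => loss ζ (ξ t)) (sgd μ L loss ξ t)) :=
      h.measurable_gradient.comp (ih.prodMk (measurable_pi_apply t))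
    exact (measurable_ballProj _).comp (by fun_prop)

lemma measurable_sgdAverage {μ L : ℝ} {loss : Euc d → Euc s → ℝ} (h : IsRegularLoss μ L loss)
    (N : ℕ) : Measurable (sgdAverage μ L loss N) := by
  have := measurable_sgd h
  unfold sgdAverage
  fun_prop

lemma sum_range_weights (N : ℕ) :
    ∑ i ∈ Finset.range N, ((i : ℝ) + 1) = N * (N + 1) / 2 := by
  induction N with
  | zero => simp
  | succ N ih => rw [Finset.sum_range_succ, ih]; push_cast; ring

lemma sgdAverage_mem {μ L : ℝ} (hμ : 0 < μ) (hL : 0 < L) (loss : Euc d → Euc s → ℝ)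
    (ξ : ℕ → Euc s) {N : ℕ} (hN : 1 ≤ N) :
    sgdAverage μ L loss N ξ ∈ Metric.closedBall (0 : Euc d) (L / (2 * μ)) := by
  have hNpos : (0 : ℝ) < N := by exact_mod_cast hN
  rw [sgdAverage, Finset.smul_sum]
  simp_rw [smul_smul]
  refine (convex_closedBall (0 : Euc d) _).sum_mem (fun i _ => by positivity) ?_
    (fun i _ => sgd_mem hμ hL loss ξ i)
  rw [← Finset.mul_sum, sum_range_weights]
  field_simp

/-- Regret bound along every data sequence: with step size `2 / (μ (t + 2))` and weight `t + 1`,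
the strong convexity term makes the squared distances to `θ` telescope. -/
lemma sgd_weighted_regret {μ L : ℝ} (hμ : 0 < μ) (hL : 0 < L) {loss : Euc d → Euc s → ℝ}
    (h : IsRegularLoss μ L loss) (ξ : ℕ → Euc s) {θ : Euc d}
    (hθ : θ ∈ Metric.closedBall (0 : Euc d) (L / (2 * μ))) (N : ℕ) :
    ∑ t ∈ Finset.range N, ((t : ℝ) + 1) * (loss (sgd μ L loss ξ t) (ξ t) - loss θ (ξ t))
      + μ / 4 * N * (N + 1) * ‖sgd μ L loss ξ N - θ‖ ^ 2 ≤ N * (4 * L ^ 2 / μ) := by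
  have hR : 0 < L / (2 * μ) := by positivity
  induction N with
  | zero => simp
  | succ N ih =>
    rw [Finset.sum_range_succ]
    push_cast
    set x := sgd μ L loss ξ N with hx
    set g := gradient (fun ζ => loss ζ (ξ N)) x with hg
    have hxm : x ∈ Metric.closedBall (0 : Euc d) (L / (2 * μ)) := sgd_mem hμ hL loss ξ N
    have hgn : ‖g‖ ≤ 2 * L := h.norm_gradient_le hμ hL (ξ N) hxm
    have hsc := h.strongly_convex (ξ N) x hxm θ hθ
    rw [← hg, norm_sub_rev θ x, ← neg_sub x θ, inner_neg_right] at hsc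
    have hN : (0 : ℝ) < (N : ℝ) + 2 := by positivity
    have hN1 : (0 : ℝ) ≤ N := Nat.cast_nonneg N
    set η : ℝ := 2 / (μ * (N + 2)) with hη
    have hηpos : 0 < η := by positivity
    have hηmul : η * (μ * (N + 2)) = 2 := by rw [hη]; field_simp
    have hstep : ‖sgd μ L loss ξ (N + 1) - θ‖ ^ 2
        ≤ ‖x - θ‖ ^ 2 - 2 * η * inner ℝ g (x - θ) + η ^ 2 * (4 * L ^ 2) := by
      have h1 : ‖sgd μ L loss ξ (N + 1) - θ‖ ≤ ‖x - η • g - θ‖ :=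
        norm_ballProj_sub_le hR _ hθ
      have h2 : ‖x - η • g - θ‖ ^ 2
          = ‖x - θ‖ ^ 2 - 2 * η * inner ℝ g (x - θ) + η ^ 2 * ‖g‖ ^ 2 := by
        rw [sub_right_comm, norm_sub_sq_real, norm_smul, Real.norm_of_nonneg hηpos.le,
          inner_smul_right, real_inner_comm]
        ring
      have h3 : ‖g‖ ^ 2 ≤ 4 * L ^ 2 := by nlinarith [norm_nonneg g]
      calc _ ≤ ‖x - η • g - θ‖ ^ 2 := by gcongr
        _ ≤ _ := by rw [h2]; gcongr
    set f := loss x (ξ N) - loss θ (ξ N) with hf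
    set a := ‖x - θ‖ ^ 2 with ha
    set b := ‖sgd μ L loss ξ (N + 1) - θ‖ ^ 2 with hb
    have hfle : f ≤ inner ℝ g (x - θ) - μ / 2 * a := by rw [hf]; linarith
    have hb' : b ≤ a - 2 * η * (f + μ / 2 * a) + η ^ 2 * (4 * L ^ 2) := by
      have := mul_le_mul_of_nonneg_left (sub_nonneg.2 hfle) (by positivity : 0 ≤ 2 * η)
      nlinarith
    -- multiply by `μ (N + 1) (N + 2) / 4` and use `η μ (N + 2) = 2`
    have hmul := mul_le_mul_of_nonneg_left hb'
      (by positivity : 0 ≤ μ / 4 * ((N : ℝ) + 1) * (N + 2))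
    have hexp : μ / 4 * ((N : ℝ) + 1) * (N + 2) *
        (a - 2 * η * (f + μ / 2 * a) + η ^ 2 * (4 * L ^ 2))
        = μ / 4 * N * (N + 1) * a - (N + 1) * f + (N + 1) * (η * (2 * L ^ 2)) := by
      linear_combination ((N : ℝ) + 1) / 4 *
        (-2 * (f + μ / 2 * a) + η * (4 * L ^ 2)) * hηmul
    have hlast : ((N : ℝ) + 1) * (η * (2 * L ^ 2)) ≤ 4 * L ^ 2 / μ := by
      rw [hη, le_div_iff₀ hμ]
      have : ((N : ℝ) + 1) * (2 / (μ * (N + 2)) * (2 * L ^ 2)) * μ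
          = ((N : ℝ) + 1) / (N + 2) * (4 * L ^ 2) := by field_simp; ring
      rw [this]
      have h1 : ((N : ℝ) + 1) / (N + 2) ≤ 1 := (div_le_one hN).2 (by linarith)
      nlinarith [sq_nonneg L]
    rw [hexp] at hmul
    nlinarith [hmul, hlast, ih]

/-- The loss bounds itself from below at the average by its tangent there, whose weighted sum over
the iterates vanishes. -/
lemma loss_sgdAverage_le {μ L : ℝ} (hμ : 0 < μ) (hL : 0 < L) {loss : Euc d → Euc s → ℝ}
    (h : IsRegularLoss μ L loss) (ξ : ℕ → Euc s) {N : ℕ} (hN : 1 ≤ N) (ζ : Euc s) :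
    (N * (N + 1) / 2 : ℝ) * loss (sgdAverage μ L loss N ξ) ζ
      ≤ ∑ t ∈ Finset.range N, ((t : ℝ) + 1) * loss (sgd μ L loss ξ t) ζ := by
  have hNpos : (0 : ℝ) < N := by exact_mod_cast hN
  set y := sgdAverage μ L loss N ξ with hy
  set g := gradient (fun θ => loss θ ζ) y
  have hym := sgdAverage_mem hμ hL loss ξ hN
  have htan : ∀ t, loss y ζ + inner ℝ g (sgd μ L loss ξ t - y) ≤ loss (sgd μ L loss ξ t) ζ := by
    intro t
    have := h.strongly_convex ζ y hym _ (sgd_mem hμ hL loss ξ t)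
    have h2 : 0 ≤ μ / 2 * ‖sgd μ L loss ξ t - y‖ ^ 2 := by positivity
    linarith
  have hzero : ∑ t ∈ Finset.range N, ((t : ℝ) + 1) • (sgd μ L loss ξ t - y) = 0 := by
    simp_rw [smul_sub]
    rw [Finset.sum_sub_distrib, ← Finset.sum_smul, sum_range_weights, sub_eq_zero, hy, sgdAverage,
      smul_smul]
    have : (N * (N + 1) / 2 : ℝ) * (2 / (N * (N + 1))) = 1 := by field_simp
    rw [this, one_smul]
  calc (N * (N + 1) / 2 : ℝ) * loss y ζ
      = ∑ t ∈ Finset.range N, ((t : ℝ) + 1) * loss y ζ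
        + inner ℝ g (∑ t ∈ Finset.range N, ((t : ℝ) + 1) • (sgd μ L loss ξ t - y)) := by
        rw [hzero, inner_zero_right, ← Finset.sum_mul, sum_range_weights, add_zero]
    _ = ∑ t ∈ Finset.range N,
          ((t : ℝ) + 1) * (loss y ζ + inner ℝ g (sgd μ L loss ξ t - y)) := by
        rw [inner_sum, ← Finset.sum_add_distrib]
        exact Finset.sum_congr rfl fun t _ => by rw [inner_smul_right]; ring
    _ ≤ _ := Finset.sum_le_sum fun t _ => mul_le_mul_of_nonneg_left (htan t) (by positivity)

/-! ### Expected excess risk of the average -/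

/-- The iterate `t` is a function of the data points before `t`, hence independent of the data
point `t`. -/
lemma map_sgd_prodMk_eval {μ L : ℝ} {loss : Euc d → Euc s → ℝ} (h : IsRegularLoss μ L loss)
    (P : Measure (Euc s)) [IsProbabilityMeasure P] (t : ℕ) :
    (Measure.infinitePi (fun _ : ℕ => P)).map (fun ξ => (sgd μ L loss ξ t, ξ t))
      = ((Measure.infinitePi (fun _ : ℕ => P)).map (fun ξ => sgd μ L loss ξ t)).prod P := by
  classical
  have hind := (ProbabilityTheory.iIndepFun_infinitePi (P := fun _ : ℕ => P)
    (X := fun _ x => x) (fun _ => measurable_id)).indepFun_finset (Finset.range t) {t} (by simp)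
    (fun i => measurable_pi_apply i)
  let ext : (Finset.range t → Euc s) → ℕ → Euc s := fun y i =>
    if hi : i ∈ Finset.range t then y ⟨i, hi⟩ else 0
  have hext : Measurable ext := by
    refine measurable_pi_lambda _ fun i => ?_
    by_cases hi : i ∈ Finset.range t
    · simp only [ext, hi, dite_true]; exact measurable_pi_apply _
    · simp only [ext, hi, dite_false]; exact measurable_const
  have hind' := hind.comp ((measurable_sgd h t).comp hext)
    (measurable_pi_apply (⟨t, by simp⟩ : ({t} : Finset ℕ)))
  have h1 : ((fun ξ => sgd μ L loss ξ t) ∘ ext) ∘ (fun (ξ : ℕ → Euc s) (i : Finset.range t) => ξ i)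
      = fun ξ => sgd μ L loss ξ t := by
    funext ξ
    refine sgd_congr μ L loss t fun i hi => ?_
    simp [ext, hi]
  have h2 : (fun y : ({t} : Finset ℕ) → Euc s => y ⟨t, by simp⟩) ∘
      (fun (ξ : ℕ → Euc s) (i : ({t} : Finset ℕ)) => ξ i) = fun ξ => ξ t := rfl
  rw [h1, h2] at hind'
  rw [(ProbabilityTheory.indepFun_iff_map_prod_eq_prod_map_map (measurable_sgd h t).aemeasurable
    (measurable_pi_apply t).aemeasurable).1 hind',
    (measurePreserving_eval_infinitePi (fun _ : ℕ => P) t).map_eq]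

lemma measurable_risk {μ L : ℝ} {loss : Euc d → Euc s → ℝ} (h : IsRegularLoss μ L loss)
    (P : Measure (Euc s)) [IsProbabilityMeasure P] : Measurable (risk loss P) :=
  (h.measurable.stronglyMeasurable.integral_prod_right (ν := P)).measurable

lemma abs_loss_sub_le {μ L : ℝ} (hL : 0 < L) {loss : Euc d → Euc s → ℝ}
    (h : IsRegularLoss μ L loss) {x θ : Euc d}
    (hx : x ∈ Metric.closedBall (0 : Euc d) (L / (2 * μ)))
    (hθ : θ ∈ Metric.closedBall (0 : Euc d) (L / (2 * μ))) (ξ : Euc s) :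
    |loss x ξ - loss θ ξ| ≤ L * (L / (2 * μ) + L / (2 * μ)) := by
  refine (h.lipschitz ξ x hx θ hθ).trans (mul_le_mul_of_nonneg_left ?_ hL.le)
  rw [mem_closedBall_zero_iff] at hx hθ
  exact (norm_sub_le x θ).trans (add_le_add hx hθ)

lemma abs_risk_sub_le {μ L : ℝ} (hL : 0 < L) {loss : Euc d → Euc s → ℝ}
    (h : IsRegularLoss μ L loss) {P : Measure (Euc s)} [IsProbabilityMeasure P]
    (hP : WellPosed μ L P loss) {x θ : Euc d}
    (hx : x ∈ Metric.closedBall (0 : Euc d) (L / (2 * μ)))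
    (hθ : θ ∈ Metric.closedBall (0 : Euc d) (L / (2 * μ))) :
    |risk loss P x - risk loss P θ| ≤ L * (L / (2 * μ) + L / (2 * μ)) := by
  rw [risk, risk, ← integral_sub (hP.1 x) (hP.1 θ)]
  have := norm_integral_le_of_norm_le_const (μ := P) (f := fun ξ => loss x ξ - loss θ ξ)
    (Filter.Eventually.of_forall fun ξ => abs_loss_sub_le hL h hx hθ ξ)
  simpa using this

lemma integrable_loss_sgd_sub {μ L : ℝ} (hμ : 0 < μ) (hL : 0 < L) {loss : Euc d → Euc s → ℝ}
    (h : IsRegularLoss μ L loss) (P : Measure (Euc s)) [IsProbabilityMeasure P] {θ : Euc d}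
    (hθ : θ ∈ Metric.closedBall (0 : Euc d) (L / (2 * μ))) (t : ℕ) :
    Integrable (fun ξ => loss (sgd μ L loss ξ t) (ξ t) - loss θ (ξ t))
      (Measure.infinitePi (fun _ : ℕ => P)) := by
  refine Integrable.of_bound (C := L * (L / (2 * μ) + L / (2 * μ))) (Measurable.aestronglyMeasurable
    (Measurable.sub (h.measurable.comp ((measurable_sgd h t).prodMk (measurable_pi_apply t)))
      (h.measurable.comp (measurable_const.prodMk (measurable_pi_apply t)))))
    (Filter.Eventually.of_forall fun ξ => ?_)
  exact abs_loss_sub_le hL h (sgd_mem hμ hL loss ξ t) hθ (ξ t)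

lemma integrable_risk_sub {μ L : ℝ} (hL : 0 < L) {loss : Euc d → Euc s → ℝ}
    (h : IsRegularLoss μ L loss) {P : Measure (Euc s)} [IsProbabilityMeasure P]
    (hP : WellPosed μ L P loss) {θ : Euc d}
    (hθ : θ ∈ Metric.closedBall (0 : Euc d) (L / (2 * μ))) {Ω : Type*} [MeasurableSpace Ω]
    (Q : Measure Ω) [IsFiniteMeasure Q] {x : Ω → Euc d} (hx : Measurable x)
    (hxm : ∀ ω, x ω ∈ Metric.closedBall (0 : Euc d) (L / (2 * μ))) :
    Integrable (fun ω => risk loss P (x ω) - risk loss P θ) Q :=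
  Integrable.of_bound (C := L * (L / (2 * μ) + L / (2 * μ)))
    (((measurable_risk h P).comp hx).sub measurable_const).aestronglyMeasurable
    (Filter.Eventually.of_forall fun ω => abs_risk_sub_le hL h hP (hxm ω) hθ)

lemma integral_loss_sgd_sub {μ L : ℝ} (hμ : 0 < μ) (hL : 0 < L) {loss : Euc d → Euc s → ℝ}
    (h : IsRegularLoss μ L loss) {P : Measure (Euc s)} [IsProbabilityMeasure P]
    (hP : WellPosed μ L P loss) {θ : Euc d}
    (hθ : θ ∈ Metric.closedBall (0 : Euc d) (L / (2 * μ))) (t : ℕ) :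
    ∫ ξ, (loss (sgd μ L loss ξ t) (ξ t) - loss θ (ξ t)) ∂(Measure.infinitePi (fun _ : ℕ => P))
      = ∫ ξ, (risk loss P (sgd μ L loss ξ t) - risk loss P θ)
          ∂(Measure.infinitePi (fun _ : ℕ => P)) := by
  have hm := measurable_sgd h t
  have hpair : Measurable (fun ξ : ℕ → Euc s => (sgd μ L loss ξ t, ξ t)) :=
    hm.prodMk (measurable_pi_apply t)
  have hF : Measurable (fun p : Euc d × Euc s => loss p.1 p.2 - loss θ p.2) :=
    h.measurable.sub (h.measurable.comp (measurable_const.prodMk measurable_snd))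
  have hmap := map_sgd_prodMk_eval h P t
  have hint : Integrable (fun p : Euc d × Euc s => loss p.1 p.2 - loss θ p.2)
      (((Measure.infinitePi (fun _ : ℕ => P)).map (fun ξ => sgd μ L loss ξ t)).prod P) := by
    rw [← hmap, integrable_map_measure hF.aestronglyMeasurable hpair.aemeasurable]
    exact integrable_loss_sgd_sub hμ hL h P hθ t
  have hprob : IsProbabilityMeasure
      ((Measure.infinitePi (fun _ : ℕ => P)).map (fun ξ => sgd μ L loss ξ t)) :=
    Measure.isProbabilityMeasure_map hm.aemeasurable
  calc _ = ∫ p, (loss p.1 p.2 - loss θ p.2)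
          ∂((Measure.infinitePi (fun _ : ℕ => P)).map (fun ξ => (sgd μ L loss ξ t, ξ t))) :=
        (integral_map hpair.aemeasurable hF.aestronglyMeasurable).symm
    _ = ∫ x, ∫ ζ, (loss x ζ - loss θ ζ) ∂P
          ∂((Measure.infinitePi (fun _ : ℕ => P)).map (fun ξ => sgd μ L loss ξ t)) := by
        rw [hmap, integral_prod _ hint]
    _ = ∫ x, (risk loss P x - risk loss P θ)
          ∂((Measure.infinitePi (fun _ : ℕ => P)).map (fun ξ => sgd μ L loss ξ t)) :=
        integral_congr_ae (Filter.Eventually.of_forall fun x => integral_sub (hP.1 x) (hP.1 θ))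
    _ = _ := integral_map hm.aemeasurable
        ((measurable_risk h P).sub measurable_const).aestronglyMeasurable

lemma integral_risk_sgdAverage_sub_le {μ L : ℝ} (hμ : 0 < μ) (hL : 0 < L)
    {loss : Euc d → Euc s → ℝ} (h : IsRegularLoss μ L loss) {P : Measure (Euc s)}
    [IsProbabilityMeasure P] (hP : WellPosed μ L P loss) {θ : Euc d}
    (hθ : θ ∈ Metric.closedBall (0 : Euc d) (L / (2 * μ))) {N : ℕ} (hN : 1 ≤ N) :
    ∫ ξ, (risk loss P (sgdAverage μ L loss N ξ) - risk loss P θ)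
      ∂(Measure.infinitePi (fun _ : ℕ => P)) ≤ 8 * L ^ 2 / (μ * N) := by
  have hNpos : (0 : ℝ) < N := by exact_mod_cast hN
  set Q := Measure.infinitePi (fun _ : ℕ => P) with hQ
  have hia := integrable_risk_sub hL h hP hθ Q (measurable_sgdAverage h N)
    (fun ξ => sgdAverage_mem hμ hL loss ξ hN)
  have his := fun t => integrable_risk_sub hL h hP hθ Q (measurable_sgd h t)
    (fun ξ => sgd_mem hμ hL loss ξ t)
  -- convexity of the risk at the average
  have hconv : ∀ ξ : ℕ → Euc s,
      (N * (N + 1) / 2 : ℝ) * (risk loss P (sgdAverage μ L loss N ξ) - risk loss P θ)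
        ≤ ∑ t ∈ Finset.range N,
          ((t : ℝ) + 1) * (risk loss P (sgd μ L loss ξ t) - risk loss P θ) := by
    intro ξ
    have h1 : (N * (N + 1) / 2 : ℝ) * risk loss P (sgdAverage μ L loss N ξ)
        ≤ ∑ t ∈ Finset.range N, ((t : ℝ) + 1) * risk loss P (sgd μ L loss ξ t) := by
      simp only [risk]
      simp_rw [← integral_const_mul]
      rw [← integral_finsetSum _ fun t _ => (hP.1 _).const_mul _]
      exact integral_mono ((hP.1 _).const_mul _)
        (integrable_finsetSum _ fun t _ => (hP.1 _).const_mul _)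
        fun ζ => loss_sgdAverage_le hμ hL h ξ hN ζ
    simp_rw [mul_sub]
    rw [Finset.sum_sub_distrib, ← Finset.sum_mul, sum_range_weights]
    linarith
  have hsum : ∫ ξ, ∑ t ∈ Finset.range N,
      ((t : ℝ) + 1) * (risk loss P (sgd μ L loss ξ t) - risk loss P θ) ∂Q
        ≤ N * (4 * L ^ 2 / μ) := by
    rw [integral_finsetSum _ fun t _ => (his t).const_mul _]
    simp_rw [integral_const_mul]
    have hrw : ∀ t, ∫ ξ, (risk loss P (sgd μ L loss ξ t) - risk loss P θ) ∂Q
        = ∫ ξ, (loss (sgd μ L loss ξ t) (ξ t) - loss θ (ξ t)) ∂Q :=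
      fun t => (integral_loss_sgd_sub hμ hL h hP hθ t).symm
    simp_rw [hrw, ← integral_const_mul]
    rw [← integral_finsetSum _ fun t _ =>
      (integrable_loss_sgd_sub hμ hL h P hθ t).const_mul _]
    have hle : ∀ ξ : ℕ → Euc s, ∑ t ∈ Finset.range N,
        ((t : ℝ) + 1) * (loss (sgd μ L loss ξ t) (ξ t) - loss θ (ξ t)) ≤ N * (4 * L ^ 2 / μ) := by
      intro ξ
      have h1 := sgd_weighted_regret hμ hL h ξ hθ N
      have h2 : 0 ≤ μ / 4 * N * (N + 1) * ‖sgd μ L loss ξ N - θ‖ ^ 2 := by positivity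
      linarith
    refine (integral_mono (integrable_finsetSum _ fun t _ =>
      (integrable_loss_sgd_sub hμ hL h P hθ t).const_mul _) (integrable_const _) hle).trans ?_
    simp
  have hmain : (N * (N + 1) / 2 : ℝ) *
      ∫ ξ, (risk loss P (sgdAverage μ L loss N ξ) - risk loss P θ) ∂Q ≤ N * (4 * L ^ 2 / μ) := by
    rw [← integral_const_mul]
    exact (integral_mono (hia.const_mul _)
      (integrable_finsetSum _ fun t _ => (his t).const_mul _) hconv).trans hsum
  set I := ∫ ξ, (risk loss P (sgdAverage μ L loss N ξ) - risk loss P θ) ∂Q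
  rw [le_div_iff₀ (by positivity)]
  have h4 : (N : ℝ) * ((N + 1) * I * μ) ≤ N * (8 * L ^ 2) := by
    have := mul_le_mul_of_nonneg_left hmain (by positivity : 0 ≤ 2 * μ)
    have e1 : 2 * μ * (N * (4 * L ^ 2 / μ)) = N * (8 * L ^ 2) := by field_simp; ring
    rw [e1] at this
    linarith
  have h5 := le_of_mul_le_mul_left h4 hNpos
  rcases le_total 0 I with hI | hI
  · nlinarith [mul_nonneg hI hμ.le]
  · nlinarith [mul_nonneg (neg_nonneg.2 hI) (mul_pos hμ hNpos).le, sq_nonneg L]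

/-! ### The averaging rule and the upper bounds on both computation times -/

/-- The update rule that ignores its initial model, runs `sgd` for `N` iterations, moves to
`sgdAverage` at iteration `N` and does not change the model any more. The memory holds the iteration
counter and the weighted sum of the past iterates; the seed is trivial. Since the output of a rule
is the point at which it queries its next gradient, the average cannot be reported along the way
without changing the iterates; this is why the horizon `N` is fixed in advance. -/
def sgdRule (d : ℕ) (μ L : ℝ) (N : ℕ) : UpdateRule d where
  Mem := ℕ × Euc d
  memSpace := inferInstance
  Seed := Unit
  seedSpace := inferInstance
  seedLaw := Measure.dirac ()
  seedProb := inferInstance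
  start := fun _ => (0, (0, 0))
  measurable_start := measurable_const
  step := fun p =>
    if p.2.2.1.1 + 1 < N then
      (ballProj (L / (2 * μ)) (p.1 - (2 / (μ * (p.2.2.1.1 + 2)) : ℝ) • p.2.1),
        (p.2.2.1.1 + 1, p.2.2.1.2 + ((p.2.2.1.1 : ℝ) + 1) • p.1))
    else if p.2.2.1.1 + 1 = N then
      ((2 / (N * (N + 1) : ℝ)) • (p.2.2.1.2 + ((p.2.2.1.1 : ℝ) + 1) • p.1),
        (p.2.2.1.1 + 1, p.2.2.1.2))
    else (p.1, (p.2.2.1.1 + 1, p.2.2.1.2))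
  measurable_step := by
    have hc : Measurable (fun p : Euc d × Euc d × (ℕ × Euc d) × Unit => p.2.2.1.1) := by fun_prop
    have hr : Measurable (fun p : Euc d × Euc d × (ℕ × Euc d) × Unit => (p.2.2.1.1 : ℝ)) :=
      (measurable_from_top (f := fun n : ℕ => (n : ℝ))).comp hc
    have hc1 : Measurable (fun p : Euc d × Euc d × (ℕ × Euc d) × Unit => p.2.2.1.1 + 1) :=
      (measurable_from_top (f := fun n : ℕ => n + 1)).comp hc
    have hS : Measurable (fun p : Euc d × Euc d × (ℕ × Euc d) × Unit =>
        p.2.2.1.2 + ((p.2.2.1.1 : ℝ) + 1) • p.1) :=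
      by fun_prop
    refine Measurable.ite (hc1 (MeasurableSet.of_discrete (s := {n | n < N}))) ?_
      (Measurable.ite (hc1 (MeasurableSet.of_discrete (s := {n | n = N}))) ?_ ?_)
    · exact Measurable.prodMk ((measurable_ballProj _).comp (by fun_prop)) (hc1.prodMk hS)
    · exact Measurable.prodMk (by fun_prop) (hc1.prodMk (by fun_prop))
    · exact measurable_fst.prodMk (hc1.prodMk (by fun_prop))

lemma sgdRule_run_of_lt (μ L : ℝ) (loss : Euc d → Euc s → ℝ) (θ₀ : Euc d) (N : ℕ)
    (ω : (sgdRule d μ L N).Seed) (ξ : ℕ → Euc s) (t : ℕ) (ht : t < N) :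
    (sgdRule d μ L N).run loss θ₀ ω ξ t = (sgd μ L loss ξ t,
      (t, ∑ i ∈ Finset.range t, ((i : ℝ) + 1) • sgd μ L loss ξ i)) := by
  induction t with
  | zero => simp [UpdateRule.run, sgdRule, sgd]
  | succ t ih =>
    rw [UpdateRule.run_succ, ih (by omega)]
    simp [sgdRule, sgd, ht, Finset.sum_range_succ]

lemma sgdRule_run_of_le (μ L : ℝ) (loss : Euc d → Euc s → ℝ) (θ₀ : Euc d) {N : ℕ} (hN : 1 ≤ N)
    (ω : (sgdRule d μ L N).Seed) (ξ : ℕ → Euc s) (t : ℕ) (ht : N ≤ t) :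
    ((sgdRule d μ L N).run loss θ₀ ω ξ t).1 = sgdAverage μ L loss N ξ ∧
      ((sgdRule d μ L N).run loss θ₀ ω ξ t).2.1 = t := by
  induction t, ht using Nat.le_induction with
  | base =>
    obtain ⟨M, rfl⟩ : ∃ M, N = M + 1 := ⟨N - 1, by omega⟩
    rw [UpdateRule.run_succ, sgdRule_run_of_lt μ L loss θ₀ (M + 1) ω ξ M (by omega)]
    simp [sgdRule, sgdAverage, Finset.sum_range_succ]
  | succ t ht ih =>
    have hlt : ¬ t + 1 < N := by omega
    have hne : ¬ t + 1 = N := by omega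
    rw [UpdateRule.run_succ]
    generalize (sgdRule d μ L N).run loss θ₀ ω ξ t = p at ih ⊢
    obtain ⟨h1, h2⟩ := ih
    simp only [sgdRule] at h2 ⊢
    simp [h1, h2, hlt, hne]

lemma UpdateRule.outputLaw_eq_map (A : UpdateRule d) (loss : Euc d → Euc s → ℝ) (θ₀ : Euc d)
    (P : Measure (Euc s)) [IsProbabilityMeasure P] (T : ℕ) {f : (ℕ → Euc s) → Euc d}
    (hf : Measurable f) (hrun : ∀ ω ξ, (A.run loss θ₀ ω ξ T).1 = f ξ) :
    A.outputLaw T θ₀ loss P = (Measure.infinitePi (fun _ : ℕ => P)).map f := by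
  have : (fun x : A.Seed × (ℕ → Euc s) => (A.run loss θ₀ x.1 x.2 T).1) = f ∘ Prod.snd :=
    funext fun x => hrun x.1 x.2
  rw [UpdateRule.outputLaw, this, ← Measure.map_map hf measurable_snd, Measure.map_snd_prod]
  simp

/-- The output law of `sgdRule` does not depend on its initial model, so it unlearns perfectly. -/
lemma sgdRule_mem_unlearningRules (d s : ℕ) (μ L rf : ℝ) {ε : ℝ} (hε : 0 ≤ ε) (δ : ℝ) (N : ℕ) :
    sgdRule d μ L N ∈ unlearningRules d s μ L rf ε δ := by
  intro T Dr Df Dg _ _ _ loss _ _ S _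
  have hstart : ∀ θ θ' : Euc d, ∀ (ω : (sgdRule d μ L N).Seed) (ξ : ℕ → Euc s) (t : ℕ),
      (sgdRule d μ L N).run loss θ ω ξ t = (sgdRule d μ L N).run loss θ' ω ξ t := by
    intro θ θ' ω ξ t
    induction t with
    | zero => rfl
    | succ t ih => simp only [UpdateRule.run_succ, ih]
  have heq : (sgdRule d μ L N).unlearn rf T loss Dr Df
      = (sgdRule d μ L N).unlearn rf T loss Dr Dg := by
    unfold UpdateRule.unlearn UpdateRule.outputLaw
    congr 1
    funext x
    rw [hstart]
  rw [heq]
  refine le_add_right (le_mul_of_one_le_left zero_le ?_)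
  rw [ENNReal.one_le_ofReal]
  exact Real.one_le_exp hε

lemma sgdRule_expectedExcess_le {μ L : ℝ} (hμ : 0 < μ) (hL : 0 < L) {loss : Euc d → Euc s → ℝ}
    (h : IsRegularLoss μ L loss) {P : Measure (Euc s)} [IsProbabilityMeasure P]
    (hP : WellPosed μ L P loss) (θ₀ : Euc d) {N : ℕ} (hN : 1 ≤ N) {T : ℕ} (hT : N ≤ T) :
    expectedExcess loss P ((sgdRule d μ L N).outputLaw T θ₀ loss P)
      ≤ ENNReal.ofReal (8 * L ^ 2 / (μ * N)) := by
  have hm := measurable_sgdAverage h N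
  have hmeas : Measurable (fun θ => ENNReal.ofReal (risk loss P θ -
      risk loss P (minimizer loss P))) :=
    ((measurable_risk h P).sub measurable_const).ennreal_ofReal
  rw [expectedExcess, UpdateRule.outputLaw_eq_map _ loss θ₀ P T hm
    (fun ω ξ => (sgdRule_run_of_le μ L loss θ₀ hN ω ξ T hT).1), lintegral_map hmeas hm]
  rw [← ofReal_integral_eq_lintegral_ofReal
    (integrable_risk_sub hL h hP hP.minimizer_mem _ hm
      (fun ξ => sgdAverage_mem hμ hL loss ξ hN))
    (Filter.Eventually.of_forall fun ξ => sub_nonneg.2 (hP.risk_minimizer_le _))]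
  exact ENNReal.ofReal_le_ofReal
    (integral_risk_sgdAverage_sub_le hμ hL h hP hP.minimizer_mem hN)

lemma timeToReach_le {e : ℝ} {excess : ℕ → ℝ≥0∞} {N : ℕ}
    (h : ∀ n ≥ N, excess n ≤ ENNReal.ofReal e) : timeToReach e excess ≤ N :=
  iInf₂_le N h

lemma lt_timeToReach {e : ℝ} {excess : ℕ → ℝ≥0∞} {T : ℕ}
    (h : ENNReal.ofReal e < excess T) : ((T + 1 : ℕ) : ℕ∞) ≤ timeToReach e excess := by
  refine le_iInf₂ fun N hN => ?_
  have : T < N := by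
    by_contra hlt
    exact absurd (hN T (not_lt.1 hlt)) (not_le.2 h)
  exact_mod_cast this

lemma eight_mul_div_eq_trivialRisk {μ : ℝ} (hμ : 0 < μ) (L : ℝ) (N : ℕ) :
    8 * L ^ 2 / (μ * N) = 64 * trivialRisk μ L / N := by
  rw [trivialRisk]
  rcases eq_or_ne (N : ℝ) 0 with h | h
  · simp [h]
  · field_simp; ring

lemma retrainTime_le {μ L : ℝ} (hμ : 0 < μ) (hL : 0 < L) (rf : ℝ) {e : ℝ}
    (Dr Df : Measure (Euc s)) [IsProbabilityMeasure Dr] {N : ℕ} (hN : 1 ≤ N)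
    (hNe : 64 * trivialRisk μ L / N ≤ e) : retrainTime d μ L rf e Dr Df ≤ N := by
  refine iInf_le_of_le (sgdRule d μ L N) (iSup₂_le fun loss hloss => timeToReach_le fun n hn => ?_)
  refine (sgdRule_expectedExcess_le hμ hL hloss.1 hloss.2.1 _ hN hn).trans ?_
  rw [eight_mul_div_eq_trivialRisk hμ]
  exact ENNReal.ofReal_le_ofReal hNe

lemma unlearnTime_le {μ L : ℝ} (hμ : 0 < μ) (hL : 0 < L) (rf : ℝ) {ε : ℝ} (hε : 0 ≤ ε) (δ : ℝ)
    {e : ℝ} (Dr Df : Measure (Euc s)) [IsProbabilityMeasure Dr] {N : ℕ} (hN : 1 ≤ N)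
    (hNe : 64 * trivialRisk μ L / N ≤ e) : unlearnTime d μ L rf ε δ e Dr Df ≤ N := by
  refine iInf₂_le_of_le (sgdRule d μ L N) (sgdRule_mem_unlearningRules d s μ L rf hε δ N)
    (iSup₂_le fun loss hloss => timeToReach_le fun n hn => ?_)
  refine (sgdRule_expectedExcess_le hμ hL hloss.1 hloss.2.1 _ hN hn).trans ?_
  rw [eight_mul_div_eq_trivialRisk hμ]
  exact ENNReal.ofReal_le_ofReal hNe

/-! ### Tilted quadratic losses -/

/-- The quadratic loss `μ / 2 ‖θ‖²` tilted by `L / 2` times `h ξ` in the direction `u`. -/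
def tiltedLoss (μ L : ℝ) (u : Euc d) (h : Euc s → ℝ) : Euc d → Euc s → ℝ :=
  fun θ ξ => μ / 2 * ‖θ‖ ^ 2 + L / 2 * h ξ * inner ℝ u θ

lemma tiltedLoss_hasGradientAt (μ L : ℝ) (u : Euc d) (h : Euc s → ℝ) (ξ : Euc s) (θ : Euc d) :
    HasGradientAt (fun ζ => tiltedLoss μ L u h ζ ξ) (μ • θ + (L / 2 * h ξ) • u) θ := by
  rw [hasGradientAt_iff_hasFDerivAt]
  have h1 : HasFDerivAt (fun ζ : Euc d => μ / 2 * ‖ζ‖ ^ 2) ((μ / 2) • (2 • innerSL ℝ θ)) θ :=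
    (hasStrictFDerivAt_norm_sq θ).hasFDerivAt.const_mul (μ / 2)
  have h2 : HasFDerivAt (fun ζ : Euc d => L / 2 * h ξ * inner ℝ u ζ)
      ((L / 2 * h ξ) • innerSL ℝ u) θ :=
    (innerSL ℝ u).hasFDerivAt.const_mul (L / 2 * h ξ)
  refine (h1.add h2).congr_fderiv ?_
  ext v
  simp
  ring

lemma gradient_tiltedLoss (μ L : ℝ) (u : Euc d) (h : Euc s → ℝ) (ξ : Euc s) (θ : Euc d) :
    gradient (fun ζ => tiltedLoss μ L u h ζ ξ) θ = μ • θ + (L / 2 * h ξ) • u :=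
  (tiltedLoss_hasGradientAt μ L u h ξ θ).gradient

lemma isRegularLoss_tiltedLoss {μ L : ℝ} (hμ : 0 < μ) (hL : 0 < L) {u : Euc d} (hu : ‖u‖ = 1)
    {h : Euc s → ℝ} (hm : Measurable h) (hb : ∀ ξ, |h ξ| ≤ 1) :
    IsRegularLoss μ L (tiltedLoss μ L u h) where
  measurable := by
    unfold tiltedLoss Function.uncurry
    have : Measurable (fun p : Euc d × Euc s => h p.2) := hm.comp measurable_snd
    fun_prop
  differentiable := fun ξ θ => (tiltedLoss_hasGradientAt μ L u h ξ θ).differentiableAt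
  lipschitz := by
    intro ξ θ hθ η hη
    rw [mem_closedBall_zero_iff] at hθ hη
    have h1 : |‖θ‖ ^ 2 - ‖η‖ ^ 2| ≤ L / μ * ‖θ - η‖ := by
      have hs : ‖θ‖ ^ 2 - ‖η‖ ^ 2 = (‖θ‖ + ‖η‖) * (‖θ‖ - ‖η‖) := by ring
      rw [hs, abs_mul, abs_of_nonneg (by positivity)]
      have : L / μ = L / (2 * μ) + L / (2 * μ) := by field_simp; ring
      rw [this]
      exact mul_le_mul (add_le_add hθ hη) (abs_norm_sub_norm_le θ η) (abs_nonneg _)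
        (by positivity)
    have h2 : |inner ℝ u (θ - η)| ≤ ‖θ - η‖ := by
      simpa [hu] using abs_real_inner_le_norm u (θ - η)
    have hdecomp : tiltedLoss μ L u h θ ξ - tiltedLoss μ L u h η ξ
        = μ / 2 * (‖θ‖ ^ 2 - ‖η‖ ^ 2) + L / 2 * (h ξ * inner ℝ u (θ - η)) := by
      simp only [tiltedLoss, inner_sub_right]; ring
    rw [hdecomp]
    have h3 : |h ξ * inner ℝ u (θ - η)| ≤ ‖θ - η‖ := by
      rw [abs_mul]
      exact (mul_le_mul (hb ξ) h2 (abs_nonneg _) zero_le_one).trans (one_mul _).le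
    calc |μ / 2 * (‖θ‖ ^ 2 - ‖η‖ ^ 2) + L / 2 * (h ξ * inner ℝ u (θ - η))|
        ≤ |μ / 2 * (‖θ‖ ^ 2 - ‖η‖ ^ 2)| + |L / 2 * (h ξ * inner ℝ u (θ - η))| := abs_add_le _ _
      _ = μ / 2 * |‖θ‖ ^ 2 - ‖η‖ ^ 2| + L / 2 * |h ξ * inner ℝ u (θ - η)| := by
        rw [abs_mul, abs_mul, abs_of_pos (half_pos hμ), abs_of_pos (half_pos hL)]
      _ ≤ μ / 2 * (L / μ * ‖θ - η‖) + L / 2 * ‖θ - η‖ := by gcongr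
      _ = L * ‖θ - η‖ := by field_simp; ring
  strongly_convex := by
    intro ξ θ _ η _
    rw [gradient_tiltedLoss]
    have hexp : ‖η‖ ^ 2 = ‖θ‖ ^ 2 + 2 * inner ℝ θ (η - θ) + ‖η - θ‖ ^ 2 := by
      rw [← norm_add_sq_real, add_sub_cancel]
    simp only [tiltedLoss]
    rw [hexp, inner_add_left, real_inner_smul_left, real_inner_smul_left]
    simp only [inner_sub_right]
    apply le_of_eq
    ring

lemma integrable_of_abs_le_one {h : Euc s → ℝ} (hm : Measurable h) (hb : ∀ ξ, |h ξ| ≤ 1)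
    (P : Measure (Euc s)) [IsFiniteMeasure P] : Integrable h P :=
  Integrable.of_bound hm.aestronglyMeasurable 1 (Filter.Eventually.of_forall hb)

lemma integrable_tiltedLoss (μ L : ℝ) (u : Euc d) {h : Euc s → ℝ} (hm : Measurable h)
    (hb : ∀ ξ, |h ξ| ≤ 1) (P : Measure (Euc s)) [IsProbabilityMeasure P] (θ : Euc d) :
    Integrable (tiltedLoss μ L u h θ) P :=
  (integrable_const _).add (((integrable_of_abs_le_one hm hb P).const_mul _).mul_const _)

lemma risk_tiltedLoss {μ : ℝ} (hμ : 0 < μ) (L : ℝ) {u : Euc d} (hu : ‖u‖ = 1) {h : Euc s → ℝ}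
    (hm : Measurable h) (hb : ∀ ξ, |h ξ| ≤ 1) (P : Measure (Euc s)) [IsProbabilityMeasure P]
    (θ : Euc d) :
    risk (tiltedLoss μ L u h) P θ = μ / 2 * ‖θ + (L / (2 * μ) * ∫ ξ, h ξ ∂P) • u‖ ^ 2
      - μ / 2 * (L / (2 * μ) * ∫ ξ, h ξ ∂P) ^ 2 := by
  have hi := integrable_of_abs_le_one hm hb P
  have : risk (tiltedLoss μ L u h) P θ
      = μ / 2 * ‖θ‖ ^ 2 + L / 2 * (∫ ξ, h ξ ∂P) * inner ℝ u θ := by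
    simp only [risk, tiltedLoss]
    rw [integral_add (integrable_const _) ((hi.const_mul _).mul_const _), integral_mul_const (inner ℝ u θ)]
    simp [integral_const_mul]
  rw [this, norm_add_sq_real, norm_smul, hu, mul_one, Real.norm_eq_abs, sq_abs, inner_smul_right,
    real_inner_comm]
  field_simp
  ring

lemma isUniqueMin_tiltedLoss {μ : ℝ} (hμ : 0 < μ) (L : ℝ) {u : Euc d} (hu : ‖u‖ = 1)
    {h : Euc s → ℝ} (hm : Measurable h) (hb : ∀ ξ, |h ξ| ≤ 1) (P : Measure (Euc s))
    [IsProbabilityMeasure P] :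
    IsUniqueMin (risk (tiltedLoss μ L u h) P) (-((L / (2 * μ) * ∫ ξ, h ξ ∂P) • u)) := by
  intro y hy
  rw [risk_tiltedLoss hμ L hu hm hb, risk_tiltedLoss hμ L hu hm hb, neg_add_cancel, norm_zero]
  have : 0 < ‖y + (L / (2 * μ) * ∫ ξ, h ξ ∂P) • u‖ :=
    norm_pos_iff.2 fun h0 => hy (eq_neg_of_add_eq_zero_left h0)
  have := mul_pos (half_pos hμ) (pow_pos this 2)
  linarith

lemma wellPosed_tiltedLoss {μ L : ℝ} (hμ : 0 < μ) (hL : 0 < L) {u : Euc d} (hu : ‖u‖ = 1)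
    {h : Euc s → ℝ} (hm : Measurable h) (hb : ∀ ξ, |h ξ| ≤ 1) (P : Measure (Euc s))
    [IsProbabilityMeasure P] : WellPosed μ L P (tiltedLoss μ L u h) := by
  refine ⟨integrable_tiltedLoss μ L u hm hb P, _, ?_, isUniqueMin_tiltedLoss hμ L hu hm hb P⟩
  have h1 : |∫ ξ, h ξ ∂P| ≤ 1 := by
    have := norm_integral_le_of_norm_le_const (μ := P) (f := h) (C := 1)
      (Filter.Eventually.of_forall hb)
    simpa using this
  rw [mem_closedBall_zero_iff, norm_neg, norm_smul, hu, mul_one, norm_mul, Real.norm_eq_abs,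
    Real.norm_eq_abs, abs_of_pos (by positivity)]
  exact mul_le_of_le_one_right (by positivity) h1

lemma tiltedLoss_excess {μ : ℝ} (hμ : 0 < μ) (L : ℝ) {u : Euc d} (hu : ‖u‖ = 1) {h : Euc s → ℝ}
    (hm : Measurable h) (hb : ∀ ξ, |h ξ| ≤ 1) (P : Measure (Euc s)) [IsProbabilityMeasure P]
    (θ : Euc d) :
    risk (tiltedLoss μ L u h) P θ
        - risk (tiltedLoss μ L u h) P (minimizer (tiltedLoss μ L u h) P)
      = μ / 2 * ‖θ + (L / (2 * μ) * ∫ ξ, h ξ ∂P) • u‖ ^ 2 := by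
  rw [minimizer_eq (isUniqueMin_tiltedLoss hμ L hu hm hb P), risk_tiltedLoss hμ L hu hm hb,
    risk_tiltedLoss hμ L hu hm hb, neg_add_cancel, norm_zero]
  ring

lemma isProbabilityMeasure_mixture {rf : ℝ} (h0 : 0 ≤ rf) (h1 : rf < 1) (Dr Df : Measure (Euc s))
    [IsProbabilityMeasure Dr] [IsProbabilityMeasure Df] :
    IsProbabilityMeasure (mixture rf Dr Df) := by
  constructor
  simp only [mixture, Measure.add_apply, Measure.smul_apply, measure_univ, smul_eq_mul, mul_one]
  rw [← ENNReal.ofReal_add h0 (by linarith)]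
  simp

lemma integral_mixture {rf : ℝ} (h0 : 0 ≤ rf) (h1 : rf < 1) {Dr Df : Measure (Euc s)}
    {h : Euc s → ℝ} (hr : Integrable h Dr) (hf : Integrable h Df) :
    ∫ ξ, h ξ ∂(mixture rf Dr Df) = rf * ∫ ξ, h ξ ∂Df + (1 - rf) * ∫ ξ, h ξ ∂Dr := by
  rw [mixture, integral_add_measure (hf.smul_measure ENNReal.ofReal_ne_top)
    (hr.smul_measure ENNReal.ofReal_ne_top), integral_smul_measure, integral_smul_measure,
    ENNReal.toReal_ofReal h0, ENNReal.toReal_ofReal (by linarith)]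
  rfl

/-! ### Tilts by a random sign -/

/-- The sign `1` or `-1` attached to a Boolean. -/
def boolSign (b : Bool) : ℝ := if b then 1 else -1

open Classical in
/-- The tilt that takes the value `a` on `F` and, off `F`, the sign of the membership in `A`. -/
def signTilt (F A : Set (Euc s)) (a : ℝ) (ξ : Euc s) : ℝ :=
  if ξ ∈ F then a else boolSign (decide (ξ ∈ A))

lemma measurable_signTilt {F A : Set (Euc s)} (hF : MeasurableSet F) (hA : MeasurableSet A)
    (a : ℝ) : Measurable (signTilt F A a) := by
  classical
  have h2 : Measurable (fun ξ : Euc s => boolSign (decide (ξ ∈ A))) := by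
    simp only [boolSign, decide_eq_true_eq]
    exact Measurable.ite hA measurable_const measurable_const
  exact Measurable.ite hF measurable_const h2

lemma abs_boolSign (b : Bool) : |boolSign b| = 1 := by
  cases b <;> simp [boolSign]

lemma abs_signTilt_le (F A : Set (Euc s)) {a : ℝ} (ha : |a| ≤ 1) (ξ : Euc s) :
    |signTilt F A a ξ| ≤ 1 := by
  unfold signTilt
  split_ifs
  · exact ha
  · exact (abs_boolSign _).le

lemma integral_signTilt_of_null {F A : Set (Euc s)} (hA : MeasurableSet A) (a : ℝ)
    {P : Measure (Euc s)} [IsProbabilityMeasure P] (hPF : P F = 0) {γ : ℝ} (hγ : -1 ≤ γ)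
    (hPA : P A = ENNReal.ofReal ((1 + γ) / 2)) : ∫ ξ, signTilt F A a ξ ∂P = γ := by
  classical
  have hae : ∀ᵐ ξ ∂P, signTilt F A a ξ = A.indicator (fun _ => (2 : ℝ)) ξ - 1 := by
    filter_upwards [measure_eq_zero_iff_ae_notMem.1 hPF] with ξ hξ
    by_cases hA : ξ ∈ A
    · simp [signTilt, boolSign, hξ, hA]; norm_num
    · simp [signTilt, boolSign, hξ, hA]
  rw [integral_congr_ae hae, integral_sub ((integrable_const _).indicator hA) (integrable_const _),
    integral_indicator_const _ hA, measureReal_def, hPA, ENNReal.toReal_ofReal (by linarith)]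
  simp

lemma integral_signTilt_of_full {F A : Set (Euc s)} (a : ℝ)
    {P : Measure (Euc s)} [IsProbabilityMeasure P] (hPF : P Fᶜ = 0) :
    ∫ ξ, signTilt F A a ξ ∂P = a := by
  have hae : ∀ᵐ ξ ∂P, signTilt F A a ξ = a := by
    filter_upwards [measure_eq_zero_iff_ae_notMem.1 hPF] with ξ hξ
    rw [signTilt, if_pos (not_not.1 hξ)]
  rw [integral_congr_ae hae]
  simp

/-! ### The law of a run on a tilted loss -/

/-- Run of a rule on a tilted loss as a function of the sequence `σ` of the tilts of the data
points. -/
def UpdateRule.tiltRun (A : UpdateRule d) (μ L : ℝ) (u θ₀ : Euc d) (ω : A.Seed) (σ : ℕ → ℝ) :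
    ℕ → Euc d × A.Mem
  | 0 => A.start (θ₀, ω)
  | t + 1 =>
    let p := A.tiltRun μ L u θ₀ ω σ t
    A.step (p.1, μ • p.1 + (L / 2 * σ t) • u, p.2, ω)

lemma UpdateRule.run_tiltedLoss (A : UpdateRule d) (μ L : ℝ) (u θ₀ : Euc d) (h : Euc s → ℝ)
    (ω : A.Seed) (ξ : ℕ → Euc s) (t : ℕ) :
    A.run (tiltedLoss μ L u h) θ₀ ω ξ t = A.tiltRun μ L u θ₀ ω (fun i => h (ξ i)) t := by
  induction t with
  | zero => rfl
  | succ t ih => rw [A.run_succ, ih, gradient_tiltedLoss]; rfl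

lemma UpdateRule.tiltRun_congr (A : UpdateRule d) (μ L : ℝ) (u θ₀ : Euc d) (ω : A.Seed)
    {σ τ : ℕ → ℝ} (t : ℕ) (h : ∀ i < t, σ i = τ i) :
    A.tiltRun μ L u θ₀ ω σ t = A.tiltRun μ L u θ₀ ω τ t := by
  induction t with
  | zero => rfl
  | succ t ih =>
    simp only [UpdateRule.tiltRun]
    rw [ih fun i hi => h i (hi.trans t.lt_succ_self), h t t.lt_succ_self]

lemma UpdateRule.measurable_tiltRun (A : UpdateRule d) (μ L : ℝ) (u θ₀ : Euc d) (σ : ℕ → ℝ)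
    (t : ℕ) : Measurable (fun ω => A.tiltRun μ L u θ₀ ω σ t) := by
  induction t with
  | zero => exact A.measurable_start.comp (by fun_prop)
  | succ t ih =>
    refine A.measurable_step.comp (ih.fst.prodMk (Measurable.prodMk ?_ (ih.snd.prodMk ?_)))
    · have := ih.fst
      fun_prop
    · exact measurable_id

/-- The sequence of signs that follows `b` on the first `T` indices. -/
def signSeq {T : ℕ} (b : Fin T → Bool) (i : ℕ) : ℝ :=
  if h : i < T then boolSign (b ⟨i, h⟩) else 0

/-- Probability of the sign vector `b` when its entries are independent with mean `γ`. -/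
def signProb {T : ℕ} (γ : ℝ) (b : Fin T → Bool) : ℝ := ∏ i, (1 + γ * boolSign (b i)) / 2

lemma signProb_nonneg {T : ℕ} {γ : ℝ} (hγ : |γ| ≤ 1) (b : Fin T → Bool) : 0 ≤ signProb γ b := by
  refine Finset.prod_nonneg fun i _ => ?_
  have h1 : |γ * boolSign (b i)| ≤ 1 := by rw [abs_mul, abs_boolSign, mul_one]; exact hγ
  linarith [(abs_le.1 h1).1]

lemma infinitePi_signs_eq {A : Set (Euc s)} (hA : MeasurableSet A) {P : Measure (Euc s)}
    [IsProbabilityMeasure P] {γ : ℝ} (hγ : |γ| ≤ 1) (hPA : P A = ENNReal.ofReal ((1 + γ) / 2))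
    {T : ℕ} (b : Fin T → Bool) :
    Measure.infinitePi (fun _ : ℕ => P) {ξ | ∀ i : Fin T, (ξ i ∈ A ↔ b i = true)}
      = ENNReal.ofReal (signProb γ b) := by
  classical
  obtain ⟨hγ1, hγ2⟩ := abs_le.1 hγ
  let t : ℕ → Set (Euc s) := fun i => if h : i < T then (if b ⟨i, h⟩ then A else Aᶜ) else Set.univ
  have ht : ∀ i, MeasurableSet (t i) := by
    intro i
    simp only [t]
    split_ifs
    · exact hA
    · exact hA.compl
    · exact MeasurableSet.univ
  have hset : {ξ : ℕ → Euc s | ∀ i : Fin T, (ξ i ∈ A ↔ b i = true)}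
      = Set.pi (Finset.range T : Set ℕ) t := by
    ext ξ
    simp only [Set.mem_ofPred_eq, Set.mem_pi, Finset.coe_range, Set.mem_Iio]
    constructor
    · intro h i hi
      have := h ⟨i, hi⟩
      simp only [t, hi, dite_true]
      split_ifs with hb
      · exact this.2 hb
      · exact fun hmem => hb (this.1 hmem)
    · intro h i
      have := h i i.2
      simp only [t, i.2, dite_true] at this
      split_ifs at this with hb
      · simpa [hb] using this
      · simpa [hb] using this
  rw [hset, Measure.infinitePi_pi _ fun i _ => ht i, Finset.prod_range, signProb,
    ENNReal.ofReal_prod_of_nonneg]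
  · refine Finset.prod_congr rfl fun i _ => ?_
    simp only [t, i.2, dite_true, Fin.eta]
    cases hb : b i
    · have h1 : (1 : ℝ≥0∞) = ENNReal.ofReal 1 := by simp
      simp only [Bool.false_eq_true, if_false, boolSign]
      rw [prob_compl_eq_one_sub hA, hPA, h1, ← ENNReal.ofReal_sub _ (by linarith)]
      congr 1; ring
    · simp only [if_true, boolSign, hPA, mul_one]
  · intro i _
    cases b i <;> simp [boolSign] <;> linarith

/-- The expected excess risk on a loss tilted by signs of mean `γ` is an average over the sign
vectors in which the loss enters through the weights and the minimizer alone: the models reached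
are the same for all such losses. -/
lemma expectedExcess_signTilt {μ L : ℝ} (hμ : 0 < μ) (hL : 0 < L) {u : Euc d} (hu : ‖u‖ = 1)
    {F A : Set (Euc s)} (hF : MeasurableSet F) (hA : MeasurableSet A) {a : ℝ} (ha : |a| ≤ 1)
    {P : Measure (Euc s)} [IsProbabilityMeasure P] (hPF : P F = 0) {γ : ℝ} (hγ : |γ| ≤ 1)
    (hPA : P A = ENNReal.ofReal ((1 + γ) / 2)) (B : UpdateRule d) (θ₀ : Euc d) (T : ℕ) :
    expectedExcess (tiltedLoss μ L u (signTilt F A a)) P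
        (B.outputLaw T θ₀ (tiltedLoss μ L u (signTilt F A a)) P)
      = ∫⁻ ω, ENNReal.ofReal (∑ b : Fin T → Bool, signProb γ b *
          (μ / 2 * ‖(B.tiltRun μ L u θ₀ ω (signSeq b) T).1 + (L / (2 * μ) * γ) • u‖ ^ 2))
          ∂B.seedLaw := by
  classical
  have hm := measurable_signTilt hF hA a
  have hb := abs_signTilt_le F A ha
  have hreg := isRegularLoss_tiltedLoss hμ hL hu hm hb
  have hmeas : Measurable (fun θ : Euc d =>
      ENNReal.ofReal (μ / 2 * ‖θ + (L / (2 * μ) * γ) • u‖ ^ 2)) := by fun_prop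
  rw [expectedExcess]
  simp_rw [tiltedLoss_excess hμ L hu hm hb P, integral_signTilt_of_null hA a hPF (abs_le.1 hγ).1 hPA]
  have hrun := (B.measurable_run hreg θ₀ T).fst
  have hcomp : Measurable (fun x : B.Seed × (ℕ → Euc s) => ENNReal.ofReal (μ / 2 *
      ‖(B.run (tiltedLoss μ L u (signTilt F A a)) θ₀ x.1 x.2 T).1
        + (L / (2 * μ) * γ) • u‖ ^ 2)) := hmeas.comp hrun
  rw [UpdateRule.outputLaw, lintegral_map hmeas hrun, lintegral_prod _ hcomp.aemeasurable]
  refine lintegral_congr fun ω => ?_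
  -- the sign vector of the first `T` data points
  let σ : (ℕ → Euc s) → Fin T → Bool := fun ξ i => decide (ξ i ∈ A)
  have hσ : Measurable σ := by
    refine measurable_pi_lambda _ fun i => ?_
    have : Measurable (fun x : Euc s => decide (x ∈ A)) :=
      measurable_to_bool (by simpa [Set.preimage] using hA)
    exact this.comp (measurable_pi_apply _)
  have hae : ∀ᵐ ξ ∂(Measure.infinitePi (fun _ : ℕ => P)), ∀ i, ξ i ∉ F := by
    rw [ae_all_iff]
    intro i
    exact (measurePreserving_eval_infinitePi (fun _ : ℕ => P) i).quasiMeasurePreserving.ae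
      (measure_eq_zero_iff_ae_notMem.1 hPF)
  let G : (Fin T → Bool) → ℝ≥0∞ := fun b => ENNReal.ofReal
    (μ / 2 * ‖(B.tiltRun μ L u θ₀ ω (signSeq b) T).1 + (L / (2 * μ) * γ) • u‖ ^ 2)
  have hG : ∀ᵐ ξ ∂(Measure.infinitePi (fun _ : ℕ => P)), ENNReal.ofReal (μ / 2 *
      ‖(B.run (tiltedLoss μ L u (signTilt F A a)) θ₀ ω ξ T).1 + (L / (2 * μ) * γ) • u‖ ^ 2)
        = G (σ ξ) := by
    filter_upwards [hae] with ξ hξ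
    have : B.run (tiltedLoss μ L u (signTilt F A a)) θ₀ ω ξ T
        = B.tiltRun μ L u θ₀ ω (signSeq (σ ξ)) T := by
      rw [B.run_tiltedLoss]
      refine B.tiltRun_congr μ L u θ₀ ω T fun i hi => ?_
      simp [signTilt, hξ i, signSeq, hi, σ]
    rw [this]
  rw [lintegral_congr_ae hG, ← lintegral_map (μ := Measure.infinitePi (fun _ : ℕ => P)) (f := G)
    (measurable_of_finite G) hσ, lintegral_fintype,
    ENNReal.ofReal_sum_of_nonneg fun b _ => mul_nonneg (signProb_nonneg hγ b) (by positivity)]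
  refine Finset.sum_congr rfl fun b _ => ?_
  rw [Measure.map_apply hσ (measurableSet_singleton b),
    ENNReal.ofReal_mul (signProb_nonneg hγ b), mul_comm, ← infinitePi_signs_eq hA hγ hPA b]
  congr 2
  ext ξ
  simp only [σ, Set.mem_preimage, Set.mem_singleton_iff, Set.mem_ofPred_eq, funext_iff]
  refine forall_congr' fun i => ?_
  cases b i <;> simp

/-! ### Overlap of two product laws of signs -/

lemma sum_signProb (T : ℕ) (γ : ℝ) : ∑ b : Fin T → Bool, signProb γ b = 1 := by
  have h := Finset.prod_univ_sum (fun _ : Fin T => (Finset.univ : Finset Bool))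
    (fun _ c => (1 + γ * boolSign c) / 2)
  rw [Fintype.piFinset_univ] at h
  simp only [signProb]
  rw [← h]
  refine Finset.prod_eq_one fun i _ => ?_
  simp [boolSign]
  ring

lemma signProb_mul_signProb_neg {T : ℕ} (γ : ℝ) (b : Fin T → Bool) :
    signProb γ b * signProb (-γ) b = ((1 - γ ^ 2) / 4) ^ T := by
  rw [signProb, signProb, ← Finset.prod_mul_distrib]
  have : ∀ i, (1 + γ * boolSign (b i)) / 2 * ((1 + -γ * boolSign (b i)) / 2)
      = (1 - γ ^ 2) / 4 := by
    intro i
    cases b i <;> simp [boolSign] <;> ring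
  simp only [this, Finset.prod_const, Finset.card_univ, Fintype.card_fin]

/-- Common mass of the laws of `T` independent signs of mean `γ` and of mean `-γ`. -/
def signOverlap (T : ℕ) (γ : ℝ) : ℝ :=
  ∑ b : Fin T → Bool, min (signProb γ b) (signProb (-γ) b)

lemma signOverlap_zero (γ : ℝ) : signOverlap 0 γ = 1 := by
  simp [signOverlap, signProb]

/-- The product of the two densities does not depend on the signs, so the tangent of
`x ↦ 1 / x` bounds their minimum from below by an affine function of their sum. -/
lemma le_signOverlap (T : ℕ) {γ : ℝ} (hγ : |γ| ≤ 1) : (1 - T * γ ^ 2) / 2 ≤ signOverlap T γ := by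
  have hγ2 : γ ^ 2 ≤ 1 := by rw [← sq_abs]; nlinarith [abs_nonneg γ]
  have hpt : ∀ b : Fin T → Bool,
      (1 - γ ^ 2) ^ T * ((1 / 2) ^ T - (signProb γ b + signProb (-γ) b) / 4)
        ≤ min (signProb γ b) (signProb (-γ) b) := by
    intro b
    have hp := signProb_nonneg hγ b
    have hq := signProb_nonneg (γ := -γ) (by rwa [abs_neg]) b
    have hpq := signProb_mul_signProb_neg γ b
    set p := signProb γ b
    set q := signProb (-γ) b
    have hm : (1 - γ ^ 2) ^ T = p * q * (2 ^ T) ^ 2 := by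
      rw [hpq, ← pow_mul, mul_comm T 2, pow_mul, ← mul_pow]
      norm_num
    have hh : ((1 : ℝ) / 2) ^ T * 2 ^ T = 1 := by rw [← mul_pow]; norm_num
    have hM : (0 : ℝ) < 2 ^ T := by positivity
    rw [hm]
    generalize (2 : ℝ) ^ T = M at hh hM
    generalize ((1 : ℝ) / 2) ^ T = m at hh
    have hexp : p * q * M ^ 2 * (m - (p + q) / 4) = p * q * (M - M ^ 2 * (p + q) / 4) := by
      linear_combination p * q * M * hh
    rw [hexp]
    refine le_min ?_ ?_
    · have : q * (M - M ^ 2 * (p + q) / 4) ≤ 1 := by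
        nlinarith [sq_nonneg (M * q / 2 - 1), mul_nonneg (sq_nonneg M) (mul_nonneg hp hq)]
      nlinarith [mul_le_mul_of_nonneg_left this hp]
    · have : p * (M - M ^ 2 * (p + q) / 4) ≤ 1 := by
        nlinarith [sq_nonneg (M * p / 2 - 1), mul_nonneg (sq_nonneg M) (mul_nonneg hp hq)]
      nlinarith [mul_le_mul_of_nonneg_left this hq]
  have hsum : ∑ b : Fin T → Bool,
      (1 - γ ^ 2) ^ T * ((1 / 2) ^ T - (signProb γ b + signProb (-γ) b) / 4)
        = (1 - γ ^ 2) ^ T / 2 := by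
    rw [← Finset.mul_sum, Finset.sum_sub_distrib, ← Finset.sum_div, Finset.sum_add_distrib,
      sum_signProb, sum_signProb]
    have hc : ∑ _b : Fin T → Bool, ((1 : ℝ) / 2) ^ T = 1 := by
      simp
    rw [hc]
    ring
  have hbern := one_add_mul_le_pow (a := -γ ^ 2) (by linarith) T
  have hle := Finset.sum_le_sum fun b (_ : b ∈ Finset.univ) => hpt b
  rw [hsum] at hle
  have hrw : 1 + -γ ^ 2 = 1 - γ ^ 2 := by ring
  rw [hrw] at hbern
  rw [signOverlap]
  linarith

/-! ### Losses that make both the initial model and few gradients uninformative -/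

/-- The tilt has mean `±γ` under the retain distribution and `∓γ (1 - rf) / rf` under the forget
distribution, so that it has mean `0` under the mixture: the unlearner starts at `0` in both cases.
Its models have the same joint law with the observed signs up to the law of the signs, and no model
is close to both retain minimizers. -/
lemma exists_loss_lt_expectedExcess {μ L rf γ e : ℝ} (hd : 1 ≤ d) (hμ : 0 < μ) (hL : 0 < L)
    (hrf : 0 ≤ rf) (hrf1 : rf < 1) (hγ : 0 < γ) (hγ1 : γ ≤ 1) (hγrf : γ * (1 - rf) ≤ rf)
    {Dr Df : Measure (Euc s)} [IsProbabilityMeasure Dr] [IsProbabilityMeasure Df]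
    (hflex : FlexibleDistributions Dr Df) (A : UpdateRule d) (T : ℕ)
    (he0 : 0 ≤ e) (he : e < γ ^ 2 * trivialRisk μ L * signOverlap T γ) :
    ∃ loss ∈ lossClass (d := d) μ L rf Dr Df, minimizer loss (mixture rf Dr Df) = 0 ∧
      ENNReal.ofReal e < expectedExcess loss Dr (A.outputLaw T 0 loss Dr) := by
  obtain ⟨hflexp, Dg, -, hdisj, -, -⟩ := hflex
  obtain ⟨E, hE, hDrE⟩ := hflexp ((1 + γ) / 2) ⟨by linarith, by linarith⟩
  have hrfpos : 0 < rf := lt_of_lt_of_le (mul_pos hγ (by linarith)) hγrf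
  set F := Df.support with hFdef
  have hF : MeasurableSet F := Measure.isClosed_support.measurableSet
  have hDfF : Df Fᶜ = 0 := Measure.measure_compl_support
  have hDrF : Dr F = 0 :=
    measure_mono_null hdisj.symm.subset_compl_right Measure.measure_compl_support
  have hprob := isProbabilityMeasure_mixture hrf hrf1 Dr Df
  obtain ⟨u, hu⟩ : ∃ u : Euc d, ‖u‖ = 1 := ⟨EuclideanSpace.single ⟨0, hd⟩ 1, by simp⟩
  have habs : |γ| ≤ 1 := abs_le.2 ⟨by linarith, hγ1⟩
  -- a tilt of mean `σ` on the retain data, balanced on the forget data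
  have hmember : ∀ (σ : ℝ) (B : Set (Euc s)), |σ| = γ → MeasurableSet B →
      Dr B = ENNReal.ofReal ((1 + σ) / 2) →
      |-(σ * (1 - rf) / rf)| ≤ 1 ∧
      tiltedLoss μ L u (signTilt F B (-(σ * (1 - rf) / rf))) ∈ lossClass μ L rf Dr Df ∧
      minimizer (tiltedLoss μ L u (signTilt F B (-(σ * (1 - rf) / rf)))) (mixture rf Dr Df)
        = 0 := by
    intro σ B hσ hB hDrB
    have ha : |-(σ * (1 - rf) / rf)| ≤ 1 := by
      rw [abs_neg, abs_div, abs_mul, hσ, abs_of_pos hrfpos, abs_of_pos (by linarith : 0 < 1 - rf)]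
      exact (div_le_one hrfpos).2 hγrf
    have hm := measurable_signTilt hF hB (-(σ * (1 - rf) / rf))
    have hb := abs_signTilt_le F B ha
    refine ⟨ha, ⟨isRegularLoss_tiltedLoss hμ hL hu hm hb, wellPosed_tiltedLoss hμ hL hu hm hb Dr,
      wellPosed_tiltedLoss hμ hL hu hm hb _⟩, ?_⟩
    have hmean : ∫ ξ, signTilt F B (-(σ * (1 - rf) / rf)) ξ ∂(mixture rf Dr Df) = 0 := by
      rw [integral_mixture hrf hrf1 (integrable_of_abs_le_one hm hb Dr)
        (integrable_of_abs_le_one hm hb Df), integral_signTilt_of_full _ hDfF,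
        integral_signTilt_of_null hB _ hDrF (by linarith [neg_abs_le σ]) hDrB]
      field_simp
      ring
    rw [minimizer_eq (isUniqueMin_tiltedLoss hμ L hu hm hb _), hmean]
    simp
  have hDrEc : Dr Eᶜ = ENNReal.ofReal ((1 + -γ) / 2) := by
    have h1 : (1 : ℝ≥0∞) = ENNReal.ofReal 1 := by simp
    rw [prob_compl_eq_one_sub hE, hDrE, h1, ← ENNReal.ofReal_sub _ (by linarith)]
    congr 1; ring
  obtain ⟨ha₁, hl₁, hmin₁⟩ := hmember γ E (abs_of_pos hγ) hE hDrE
  obtain ⟨ha₂, hl₂, hmin₂⟩ := hmember (-γ) Eᶜ (by rw [abs_neg, abs_of_pos hγ]) hE.compl hDrEc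
  by_contra! hcon
  have h₁ := hcon _ hl₁ hmin₁
  have h₂ := hcon _ hl₂ hmin₂
  rw [expectedExcess_signTilt hμ hL hu hF hE ha₁ hDrF habs hDrE] at h₁
  rw [expectedExcess_signTilt hμ hL hu hF hE.compl ha₂ hDrF (by rwa [abs_neg]) hDrEc] at h₂
  have hover : 0 ≤ signOverlap T γ := Finset.sum_nonneg fun b _ =>
    le_min (signProb_nonneg habs b) (signProb_nonneg (by rwa [abs_neg]) b)
  have htriv : 0 < trivialRisk μ L := by unfold trivialRisk; positivity
  have hmeas : ∀ (b : Fin T → Bool) (r : ℝ), Measurable fun ω => signProb r b *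
      (μ / 2 * ‖(A.tiltRun μ L u 0 ω (signSeq b) T).1 + (L / (2 * μ) * r) • u‖ ^ 2) := by
    intro b r
    have := (A.measurable_tiltRun μ L u 0 (signSeq b) T).fst
    fun_prop
  have hnn : ∀ (r : ℝ), |r| ≤ 1 → ∀ ω, 0 ≤ ∑ b : Fin T → Bool, signProb r b *
      (μ / 2 * ‖(A.tiltRun μ L u 0 ω (signSeq b) T).1 + (L / (2 * μ) * r) • u‖ ^ 2) :=
    fun r hr ω => Finset.sum_nonneg fun b _ => mul_nonneg (signProb_nonneg hr b) (by positivity)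
  have hpt : ∀ ω, 2 * (γ ^ 2 * trivialRisk μ L * signOverlap T γ)
      ≤ ∑ b : Fin T → Bool, signProb γ b *
          (μ / 2 * ‖(A.tiltRun μ L u 0 ω (signSeq b) T).1 + (L / (2 * μ) * γ) • u‖ ^ 2)
        + ∑ b : Fin T → Bool, signProb (-γ) b *
          (μ / 2 * ‖(A.tiltRun μ L u 0 ω (signSeq b) T).1 + (L / (2 * μ) * -γ) • u‖ ^ 2) := by
    intro ω
    rw [← Finset.sum_add_distrib, signOverlap, Finset.mul_sum, Finset.mul_sum]
    refine Finset.sum_le_sum fun b _ => ?_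
    set x := (A.tiltRun μ L u 0 ω (signSeq b) T).1
    set p := signProb γ b
    set q := signProb (-γ) b
    have hp : min p q ≤ p := min_le_left _ _
    have hq : min p q ≤ q := min_le_right _ _
    have hmin : 0 ≤ min p q :=
      le_min (signProb_nonneg habs b) (signProb_nonneg (by rwa [abs_neg]) b)
    have hpar : 2 * (γ ^ 2 * trivialRisk μ L) ≤ μ / 2 * ‖x + (L / (2 * μ) * γ) • u‖ ^ 2
        + μ / 2 * ‖x + (L / (2 * μ) * -γ) • u‖ ^ 2 := by
      have e1 : x + (L / (2 * μ) * -γ) • u = x - (L / (2 * μ) * γ) • u := by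
        rw [mul_neg, neg_smul, sub_eq_add_neg]
      have e2 : 2 * (γ ^ 2 * trivialRisk μ L) = μ * (L / (2 * μ) * γ) ^ 2 := by
        rw [trivialRisk]; field_simp; ring
      rw [e1, norm_add_sq_real, norm_sub_sq_real, norm_smul, hu, mul_one, Real.norm_eq_abs, sq_abs,
        e2]
      nlinarith [mul_nonneg hμ.le (sq_nonneg ‖x‖)]
    have hX : 0 ≤ μ / 2 * ‖x + (L / (2 * μ) * γ) • u‖ ^ 2 := by positivity
    have hY : 0 ≤ μ / 2 * ‖x + (L / (2 * μ) * -γ) • u‖ ^ 2 := by positivity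
    generalize μ / 2 * ‖x + (L / (2 * μ) * γ) • u‖ ^ 2 = X at hpar hX
    generalize μ / 2 * ‖x + (L / (2 * μ) * -γ) • u‖ ^ 2 = Y at hpar hY
    nlinarith [mul_le_mul_of_nonneg_left hpar hmin, mul_le_mul_of_nonneg_right hp hX,
      mul_le_mul_of_nonneg_right hq hY]
  have hsum := add_le_add h₁ h₂
  rw [← lintegral_add_left
    (Finset.measurable_sum _ fun b _ => hmeas b γ).ennreal_ofReal] at hsum
  have hlow : ENNReal.ofReal (2 * (γ ^ 2 * trivialRisk μ L * signOverlap T γ))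
      ≤ ENNReal.ofReal e + ENNReal.ofReal e := by
    refine le_trans ?_ hsum
    calc ENNReal.ofReal (2 * (γ ^ 2 * trivialRisk μ L * signOverlap T γ))
        = ∫⁻ _ω, ENNReal.ofReal (2 * (γ ^ 2 * trivialRisk μ L * signOverlap T γ)) ∂A.seedLaw := by
          simp
      _ ≤ _ := lintegral_mono fun ω => by
          rw [← ENNReal.ofReal_add (hnn γ habs ω) (hnn (-γ) (by rwa [abs_neg]) ω)]
          exact ENNReal.ofReal_le_ofReal (hpt ω)
  rw [← ENNReal.ofReal_add he0 he0, ENNReal.ofReal_le_ofReal_iff (add_nonneg he0 he0)] at hlow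
  linarith

/-! ### Comparison of the computation times -/

lemma kappa_sq_le {ε δ : ℝ} (hδ : (10 : ℝ) ^ (-8 : ℤ) ≤ δ) (hδε : δ ≤ ε) :
    kappa ε δ ^ 2 ≤ 4 * 10 ^ 17 := by
  have h8 : (10 : ℝ) ^ (-8 : ℤ) = 1 / 10 ^ 8 := by norm_num
  rw [h8] at hδ
  have hδpos : 0 < δ := lt_of_lt_of_le (by norm_num) hδ
  have hinv : ε⁻¹ ≤ 10 ^ 8 := by
    rw [inv_le_comm₀ (hδpos.trans_le hδε) (by norm_num), ← one_div]
    exact hδ.trans hδε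
  have hlog : Real.log (1.25 / δ) ≤ 19 := by
    have h1 : (1.25 : ℝ) / δ ≤ 2 ^ 27 := by
      rw [div_le_iff₀ hδpos]
      linarith
    have h2 := Real.log_le_log (by positivity) h1
    rw [Real.log_pow] at h2
    have h3 := Real.log_two_lt_d9
    push_cast at h2
    linarith
  have hsqrt : Real.sqrt (2 * Real.log (1.25 / δ)) ^ 2 ≤ 38 := by
    calc Real.sqrt (2 * Real.log (1.25 / δ)) ^ 2 ≤ Real.sqrt 38 ^ 2 := by
          gcongr
          linarith
      _ = 38 := Real.sq_sqrt (by norm_num)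
  have hinv0 : 0 ≤ ε⁻¹ := (inv_pos.2 (hδpos.trans_le hδε)).le
  rw [kappa, mul_pow]
  calc ε⁻¹ ^ 2 * Real.sqrt (2 * Real.log (1.25 / δ)) ^ 2
      ≤ (10 ^ 8) ^ 2 * 38 := mul_le_mul (by gcongr) hsqrt (by positivity) (by positivity)
    _ ≤ 4 * 10 ^ 17 := by norm_num

/-- Every rule, started from the minimizer for the mixture or from `0`, exceeds the risk `e` at
iteration `T` on some loss, if `T` is at most a constant times `e₀ / e`. The bias `γ` is chosen
just large enough for an error about the sign of the tilt to cost `e`. -/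
lemma exists_loss_of_few_iterations {μ L rf e : ℝ} (hd : 1 ≤ d) (hμ : 0 < μ) (hL : 0 < L)
    (hrf : 0 ≤ rf) (hrf1 : rf < 1) {Dr Df : Measure (Euc s)} [IsProbabilityMeasure Dr]
    [IsProbabilityMeasure Df] (hflex : FlexibleDistributions Dr Df) (he0 : 0 < e)
    (he : e < trivialRisk μ L) (heρ : 4 * e < (rf / (1 - rf)) ^ 2 * trivialRisk μ L)
    (A : UpdateRule d) (T : ℕ) (hT : 8 * T * e < trivialRisk μ L) :
    ∃ loss ∈ lossClass (d := d) μ L rf Dr Df, minimizer loss (mixture rf Dr Df) = 0 ∧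
      ENNReal.ofReal e < expectedExcess loss Dr (A.outputLaw T 0 loss Dr) := by
  have h1rf : 0 < 1 - rf := by linarith
  set ρ := rf / (1 - rf) with hρ
  have hρ0 : 0 ≤ ρ := div_nonneg hrf h1rf.le
  set e₀ := trivialRisk μ L with he₀
  have he₀pos : 0 < e₀ := he0.trans he
  have hρpos : 0 < ρ := by
    rcases hρ0.eq_or_lt with h | h
    · rw [← h] at heρ; norm_num at heρ; linarith
    · exact h
  have hρrf : ∀ γ ≤ ρ, γ * (1 - rf) ≤ rf := fun γ h => by
    rwa [hρ, le_div_iff₀ h1rf] at h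
  rcases Nat.eq_zero_or_pos T with rfl | hTpos
  · refine exists_loss_lt_expectedExcess hd hμ hL hrf hrf1 (lt_min one_pos hρpos)
      (min_le_left _ _) (hρrf _ (min_le_right _ _)) hflex A 0 he0.le ?_
    rw [signOverlap_zero, mul_one]
    rcases min_choice 1 ρ with h | h <;> rw [h] <;> linarith
  · have hT1 : (1 : ℝ) ≤ T := by exact_mod_cast hTpos
    have hsq : Real.sqrt (4 * e / e₀) ^ 2 = 4 * e / e₀ := Real.sq_sqrt (by positivity)
    have hγ1 : Real.sqrt (4 * e / e₀) ≤ 1 := by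
      refine Real.sqrt_le_iff.2 ⟨zero_le_one, ?_⟩
      rw [one_pow, div_le_one he₀pos]
      nlinarith
    have hγpos : 0 < Real.sqrt (4 * e / e₀) := Real.sqrt_pos.2 (by positivity)
    refine exists_loss_lt_expectedExcess hd hμ hL hrf hrf1 hγpos hγ1 (hρrf _ ?_) hflex A T he0.le ?_
    · refine Real.sqrt_le_iff.2 ⟨hρ0, ?_⟩
      rw [div_le_iff₀ he₀pos]
      exact heρ.le
    · have hover := le_signOverlap T (γ := Real.sqrt (4 * e / e₀))
        (by rwa [abs_of_pos hγpos])
      rw [hsq] at hover ⊢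
      have hTe : T * (4 * e / e₀) < 1 / 2 := by
        rw [← mul_div_assoc, div_lt_iff₀ he₀pos]
        linarith
      have h4 : 4 * e / e₀ * e₀ = 4 * e := by field_simp
      rw [← he₀, h4]
      nlinarith

end Unlearning
end

open Unlearning in
theorem theorem2 :
    ∃ c : ℝ, 0 < c ∧ ∃ K : ℝ, 0 < K ∧
      ∀ (d s : ℕ) (μ L rf ε δ e : ℝ) (Dr Df : Measure (Euc s))
        [IsProbabilityMeasure Dr] [IsProbabilityMeasure Df],
        1 ≤ d → 0 < μ → 0 < L → 0 ≤ rf → rf < 1 →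
        (10 : ℝ) ^ (-8 : ℤ) ≤ δ → δ ≤ ε →
        FlexibleDistributions Dr Df →
        0 < e →
        e < min 1 (c * (rf / (1 - rf)) ^ 2 * (1 + kappa ε δ ^ 2)) * trivialRisk μ L →
        0 < retrainTime d μ L rf e Dr Df ∧ retrainTime d μ L rf e Dr Df < ⊤ ∧
        unlearnTime d μ L rf ε δ e Dr Df < ⊤ ∧
        ENNReal.ofReal K ≤
          (unlearnTime d μ L rf ε δ e Dr Df : ℝ≥0∞) / (retrainTime d μ L rf e Dr Df : ℝ≥0∞) := by
  -- `c (1 + κ²) ≤ 1 / 4` by the bound on `κ`; `K = (1 / 8) / 65` compares the lower bound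
  -- `e₀ / (8 e)` with the upper bound `⌈64 e₀ / e⌉ ≤ 65 e₀ / e`
  refine ⟨1 / 10 ^ 19, by norm_num, 1 / 520, by norm_num, ?_⟩
  intro d s μ L rf ε δ e Dr Df _ _ hd hμ hL hrf hrf1 hδ hδε hflex he0 he
  set e₀ := trivialRisk μ L with he₀
  have he₀pos : 0 < e₀ := by rw [he₀, trivialRisk]; positivity
  have hε : 0 ≤ ε := (le_trans (by positivity) hδ).trans hδε
  have hlt1 : e < e₀ :=
    he.trans_le ((mul_le_mul_of_nonneg_right (min_le_left _ _) he₀pos.le).trans (one_mul _).le)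
  have hltρ : 4 * e < (rf / (1 - rf)) ^ 2 * e₀ := by
    have h1 := he.trans_le (mul_le_mul_of_nonneg_right (min_le_right _ _) he₀pos.le)
    have h2 : 1 / 10 ^ 19 * (1 + kappa ε δ ^ 2) ≤ 1 / 4 := by
      have := kappa_sq_le hδ hδε
      norm_num at this ⊢
      linarith
    have h3 : 0 ≤ (rf / (1 - rf)) ^ 2 * e₀ := by positivity
    have h4 := mul_le_mul_of_nonneg_right h2 h3
    linarith
  have hfew := fun (A : UpdateRule d) (T : ℕ) (hT : 8 * T * e < e₀) =>
    exists_loss_of_few_iterations hd hμ hL hrf hrf1 hflex he0 hlt1 hltρ A T hT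
  have hretrain_pos : ((0 + 1 : ℕ) : ℕ∞) ≤ retrainTime d μ L rf e Dr Df := by
    refine le_iInf fun A => ?_
    obtain ⟨loss, hmem, -, hexc⟩ := hfew A 0 (by simpa using he₀pos)
    exact le_iSup₂_of_le loss hmem (lt_timeToReach hexc)
  -- the lower bound on the unlearning time
  set M := ⌈e₀ / (8 * e)⌉₊ with hM
  have hMpos : 0 < M := Nat.ceil_pos.2 (by positivity)
  have hunlearn : (M : ℕ∞) ≤ unlearnTime d μ L rf ε δ e Dr Df := by
    obtain ⟨T, hT⟩ : ∃ T, M = T + 1 := ⟨M - 1, by omega⟩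
    have hTlt : 8 * T * e < e₀ := by
      have : (T : ℝ) < e₀ / (8 * e) := Nat.lt_ceil.1 (by omega)
      rw [lt_div_iff₀ (by positivity)] at this
      linarith
    rw [hT]
    refine le_iInf₂ fun A _ => ?_
    obtain ⟨loss, hmem, hmin, hexc⟩ := hfew A T hTlt
    refine le_iSup₂_of_le loss hmem (lt_timeToReach ?_)
    rwa [UpdateRule.unlearn, hmin]
  -- the upper bounds
  set N := ⌈64 * e₀ / e⌉₊ with hN
  have hNpos : 0 < N := Nat.ceil_pos.2 (by positivity)
  have hNR : (0 : ℝ) < N := by exact_mod_cast hNpos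
  have hNe : 64 * trivialRisk μ L / N ≤ e := by
    rw [← he₀, div_le_iff₀ hNR, mul_comm e, ← div_le_iff₀ he0]
    exact Nat.le_ceil _
  have hretrain := retrainTime_le (d := d) hμ hL rf Dr Df hNpos hNe
  have hunlearn' := unlearnTime_le (d := d) hμ hL rf hε δ Dr Df hNpos hNe
  refine ⟨lt_of_lt_of_le (by simp) hretrain_pos, lt_of_le_of_lt hretrain (ENat.natCast_lt_top N),
    lt_of_le_of_lt hunlearn' (ENat.natCast_lt_top N), ?_⟩
  have hreal : 1 / 520 * (N : ℝ) ≤ M := by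
    have h1 : (N : ℝ) < 64 * e₀ / e + 1 := Nat.ceil_lt_add_one (by positivity)
    have h2 : e₀ / (8 * e) ≤ M := Nat.le_ceil _
    have h3 : 1 ≤ e₀ / e := (one_le_div he0).2 hlt1.le
    have h4 : e₀ / (8 * e) = e₀ / e / 8 := by field_simp
    rw [mul_div_assoc] at h1
    linarith
  calc ENNReal.ofReal (1 / 520) ≤ (M : ℝ≥0∞) / (N : ℝ≥0∞) := by
        rw [ENNReal.le_div_iff_mul_le (Or.inl (by exact_mod_cast hNpos.ne'))
          (Or.inl (ENNReal.natCast_ne_top N)), ← ENNReal.ofReal_natCast N,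
          ← ENNReal.ofReal_natCast M, ← ENNReal.ofReal_mul (by norm_num)]
        exact ENNReal.ofReal_le_ofReal hreal
    _ ≤ _ := by
        refine ENNReal.div_le_div ?_ ?_
        · simpa using ENat.toENNReal_mono hunlearn
        · simpa using ENat.toENNReal_mono hretrain
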